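/- Let $n\ge 2$ be a fixed integer, and let $p=p(m)$, $m\in\mathbb N$, be positive integers for all large $m$, with $p\to\infty$ and $m/p\to c\in(0,\infty)$ as $m\to\infty$. For every $m$ let $\mathbf A_m$ be a deterministic real $m\times p$ matrix with non-negative entries such that $\frac1{mp}\operatorname{tr}(\mathbf A_m\mathbf A_m^\top)$ is bounded uniformly in $m$, and let $\boldsymbol\Sigma_m$ be a symmetric positive definite $m\times m$ matrix, with positive definite symmetric square root $\boldsymbol\Sigma_m^{1/2}$, such that $\frac1m\operatorname{tr}(\boldsymbol\Sigma_m)$ is bounded uniformly in $m$. On a common probability space let $\mathbf E_m^1,\dots,\mathbf E_m^n$ be random $m\times p$ matrices such that, for each $m$, all their $nmp$ entries are independent, the entries of each $\mathbf E_m^k$ are identically distributed, and the entries have mean zero, variance one, and absolute moments of order $4+\varepsilon$ bounded uniformly in $m$, for some $\varepsilon>0$ (no assumption is made on the joint law for different $m$). Put $$\tilde{\mathbf A}_m^k=\mathbf A_m+\boldsymbol\Sigma_m^{1/2}\mathbf E_m^k\quad(k=1,\dots,n),\qquad \bar{\mathbf A}_m=\frac1n\sum_{k=1}^n\tilde{\mathbf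 A}_m^k,$$ and let $\mathbf U_m$ be the $m\times p$ matrix with all entries equal to one. Then, as $m\to\infty$, $$\left|\frac1{(n-1)mp}\sum_{k=1}^n\operatorname{tr}\left((\tilde{\mathbf A}_m^k-\bar{\mathbf A}_m)(\tilde{\mathbf A}_m^k-\bar{\mathbf A}_m)^\top\right)-\frac1m\operatorname{tr}(\boldsymbol\Sigma_m)\right|\xrightarrow{a.s.}0 .$$ Moreover, define the data-driven shrinkage intensities $$\hat\alpha^*=1-\frac{\frac1{n(n-1)mp}\sum_{k=1}^n\operatorname{tr}\left((\tilde{\mathbf A}_m^k-\bar{\mathbf A}_m)(\tilde{\mathbf A}_m^k-\bar{\mathbf A}_m)^\top\right)}{\frac{\operatorname{tr}(\bar{\mathbf A}_m\bar{\mathbf A}_m^\top)}{mp}-\frac{\operatorname{tr}^2(\bar{\mathbf A}_m\mathbf U_m^\top)}{(mp)^2}},\qquad \hat\beta^*=(1-\hat\alpha^*)\frac{\operatorname{tr}(\bar{\mathbf A}_m\mathbf U_m^\top)}{mp},$$ and the asymptotic oracle intensities $$\alpha^*(\boldsymbol\Sigma_m)=\frac{\frac{\operatorname{tr}(\mathbf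 A_m\mathbf A_m^\top)}{mp}-\frac{\operatorname{tr}^2(\mathbf A_m\mathbf U_m^\top)}{(mp)^2}}{\frac{\operatorname{tr}(\mathbf A_m\mathbf A_m^\top)}{mp}+\frac{\operatorname{tr}(\boldsymbol\Sigma_m)}{nm}-\frac{\operatorname{tr}^2(\mathbf A_m\mathbf U_m^\top)}{(mp)^2}},\qquad \beta^*(\boldsymbol\Sigma_m)=(1-\alpha^*(\boldsymbol\Sigma_m))\frac{\operatorname{tr}(\mathbf A_m\mathbf U_m^\top)}{mp}.$$ Then almost surely the denominator of $\hat\alpha^*$ is nonzero for all large $m$, and $\hat\alpha^*$, $\hat\beta^*$ are strongly consistent: $$|\hat\alpha^*-\alpha^*(\boldsymbol\Sigma_m)|\xrightarrow{a.s.}0,\qquad |\hat\beta^*-\beta^*(\boldsymbol\Sigma_m)|\xrightarrow{a.s.}0 .$$ -/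

import Mathlib

open MeasureTheory ProbabilityTheory Filter Topology
open scoped MatrixOrder

noncomputable section

namespace Shrinkage

/-- The `m × p` target matrix all of whose entries are one. -/
def onesMatrix (m p : ℕ) : Matrix (Fin m) (Fin p) ℝ := Matrix.of fun _ _ => 1

/-- The observation `A + Σ^{1/2} E`, where `Σ^{1/2}` is the symmetric (positive semidefinite)
square root of `Σ`. -/
def observation {m p : ℕ} (A : Matrix (Fin m) (Fin p) ℝ) (S : Matrix (Fin m) (Fin m) ℝ)
    (E : Matrix (Fin m) (Fin p) ℝ) : Matrix (Fin m) (Fin p) ℝ :=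
  A + CFC.sqrt S * E

/-- The sample average of `n` observed matrices. -/
def sampleMean {n m p : ℕ} (X : Fin n → Matrix (Fin m) (Fin p) ℝ) :
    Matrix (Fin m) (Fin p) ℝ :=
  (1 / (n : ℝ)) • ∑ k, X k

/-- `(1 / (mp)) tr (X Yᵀ)`. -/
def normTrace {m p : ℕ} (X Y : Matrix (Fin m) (Fin p) ℝ) : ℝ :=
  1 / ((m : ℝ) * (p : ℝ)) * (X * Y.transpose).trace

/-- The pooled estimator `(1 / ((n - 1) m p)) ∑ₖ tr ((Xᵏ - X̄) (Xᵏ - X̄)ᵀ)`. -/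
def pooledEstimator {n m p : ℕ} (X : Fin n → Matrix (Fin m) (Fin p) ℝ) : ℝ :=
  1 / (((n : ℝ) - 1) * (m : ℝ) * (p : ℝ)) *
    ∑ k, ((X k - sampleMean X) * (X k - sampleMean X).transpose).trace

/-- The denominator `tr (X̄ X̄ᵀ) / (mp) - tr² (X̄ Uᵀ) / (mp)²` of the data-driven shrinkage
intensity. -/
def hatDenominator {n m p : ℕ} (X : Fin n → Matrix (Fin m) (Fin p) ℝ) : ℝ :=
  normTrace (sampleMean X) (sampleMean X) - normTrace (sampleMean X) (onesMatrix m p) ^ 2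

/-- The data-driven shrinkage intensity `α̂*`. -/
def alphaHat {n m p : ℕ} (X : Fin n → Matrix (Fin m) (Fin p) ℝ) : ℝ :=
  1 - (1 / ((n : ℝ) * ((n : ℝ) - 1) * (m : ℝ) * (p : ℝ)) *
    ∑ k, ((X k - sampleMean X) * (X k - sampleMean X).transpose).trace) / hatDenominator X

/-- The data-driven shrinkage intensity `β̂*`. -/
def betaHat {n m p : ℕ} (X : Fin n → Matrix (Fin m) (Fin p) ℝ) : ℝ :=
  (1 - alphaHat X) * normTrace (sampleMean X) (onesMatrix m p)

/-- The asymptotic oracle intensity `α*(Σ)`. -/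
def alphaOracle (n : ℕ) {m p : ℕ} (A : Matrix (Fin m) (Fin p) ℝ)
    (S : Matrix (Fin m) (Fin m) ℝ) : ℝ :=
  (normTrace A A - normTrace A (onesMatrix m p) ^ 2) /
    (normTrace A A + S.trace / ((n : ℝ) * (m : ℝ)) - normTrace A (onesMatrix m p) ^ 2)

/-- The asymptotic oracle intensity `β*(Σ)`. -/
def betaOracle (n : ℕ) {m p : ℕ} (A : Matrix (Fin m) (Fin p) ℝ)
    (S : Matrix (Fin m) (Fin m) ℝ) : ℝ :=
  (1 - alphaOracle n A S) * normTrace A (onesMatrix m p)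

end Shrinkage

end

/-! Write W_k = Σ^{1/2} E_k, r = 4 + ε and ⟨X, Y⟩ = tr(X Yᵀ)/(mp). The signal cancels from the
pooled estimator, and the denominator of α̂* is a polynomial in deterministic quantities and in
⟨W_k, W_l⟩, ⟨C, W_k⟩ and ⟨U, W_k⟩, where C is A minus its mean entry. It suffices to show that,
after normalization, the first family tends to δ_kl and the other two to 0 almost surely.

tr(W_k W_lᵀ)/(p tr Σ) is an average over p independent columns. Jensen's inequality bounds the
moment of order r/2 of each column term uniformly in m and Σ (`IsNoise.column_form_moment`), and the
Rosenthal-type bound `integral_abs_weighted_sum_rpow_le` then makes that moment of the centered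
average O(p^{-r/4}) (`IsNoise.quadratic_form_moment`). Since r/4 > 1 and p is comparable to m, these
moments are summable in m, which gives almost sure convergence whatever the joint law for different
m. Linear forms are smaller still (`IsNoise.linear_form_moment`). Σ enters only through its trace,
the squared Frobenius norm of Σ^{1/2}.

With t = tr Σ/m and v = ⟨C, C⟩, the oracle denominator G = v + t/n may tend to 0, so errors must be
small relative to G. They are: the cross term has size √(tv) and the remaining errors size t, both
O(G). `plugin_limits` concludes. -/

namespace Shrinkage

/-! ### Pointwise inequalities for `|s + x| ^ r` -/

/-- The odd power function `x ↦ |x| ^ q * x` is Lipschitz on bounded sets. -/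
theorem abs_signed_rpow_sub_le {q : ℝ} (hq : 0 ≤ q) (a b : ℝ) :
    |(|b| ^ q * b) - |a| ^ q * a| ≤ (q + 1) * (max |a| |b|) ^ q * |b - a| := by
  have hpos : ∀ x y : ℝ, 0 ≤ x → x ≤ y → y ^ q * y - x ^ q * x ≤ (q + 1) * y ^ q * (y - x) := by
    intro x y hx hxy
    rcases hx.eq_or_lt with rfl | hx
    · have : 0 ≤ y ^ q * y := by positivity
      nlinarith
    have hy : 0 < y := hx.trans_le hxy
    -- Bernoulli's inequality for (x/y)^(q+1): the graph of the convex power lies above its tangent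
    -- at y.
    have h := one_add_mul_self_le_rpow_one_add (s := x / y - 1)
      (by have : 0 < x / y := by positivity
          linarith) (p := q + 1) (by linarith)
    have e : (1 + (x / y - 1)) ^ (q + 1) = x ^ q * x / (y ^ q * y) := by
      rw [add_sub_cancel, Real.div_rpow hx.le hy.le, Real.rpow_add_one hx.ne',
        Real.rpow_add_one hy.ne']
    rw [e, le_div_iff₀ (by positivity)] at h
    have e2 : (1 + (q + 1) * (x / y - 1)) * (y ^ q * y) =
        y ^ q * y + (q + 1) * y ^ q * (x - y) := by field_simp
    rw [e2] at h
    linarith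
  have hmono : ∀ x y : ℝ, 0 ≤ x → x ≤ y → x ^ q * x ≤ y ^ q * y := fun x y hx hxy =>
    mul_le_mul (Real.rpow_le_rpow hx hxy hq) hxy hx (Real.rpow_nonneg (hx.trans hxy) q)
  have hle : ∀ x y : ℝ, 0 ≤ x → x ≤ y →
      |(y ^ q * y) - x ^ q * x| ≤ (q + 1) * y ^ q * (y - x) := fun x y hx hxy => by
    rw [abs_of_nonneg (sub_nonneg.2 (hmono x y hx hxy))]
    exact hpos x y hx hxy
  -- For arguments of opposite sign the difference becomes a sum of absolute values, and the factor
  -- q + 1 ≥ 1 is not even needed.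
  have hopp : ∀ x y : ℝ, 0 ≤ x → 0 ≤ y →
      y ^ q * y + x ^ q * x ≤ (q + 1) * (max x y) ^ q * (y + x) := fun x y hx hy => by
    have h1 := Real.rpow_le_rpow hx (le_max_left x y) hq
    have h2 := Real.rpow_le_rpow hy (le_max_right x y) hq
    have h0 : 0 ≤ (max x y) ^ q * (y + x) := by positivity
    have h3 := mul_le_mul_of_nonneg_right h1 hx
    have h4 := mul_le_mul_of_nonneg_right h2 hy
    nlinarith
  have hnn : ∀ x y : ℝ, 0 ≤ x → 0 ≤ y →
      |(y ^ q * y) - x ^ q * x| ≤ (q + 1) * (max x y) ^ q * |y - x| := fun x y hx hy => by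
    rcases le_total x y with h | h
    · rw [max_eq_right h, abs_of_nonneg (sub_nonneg.2 h)]
      exact hle x y hx h
    · rw [max_eq_left h, abs_sub_comm, abs_sub_comm y x, abs_of_nonneg (sub_nonneg.2 h)]
      exact hle y x hy h
  rcases le_total 0 a with ha | ha <;> rcases le_total 0 b with hb | hb
  · rw [abs_of_nonneg ha, abs_of_nonneg hb]
    exact hnn a b ha hb
  · rw [abs_of_nonneg ha, abs_of_nonpos hb]
    have h := hopp a (-b) ha (neg_nonneg.2 hb)
    have h0 : 0 ≤ (-b) ^ q * (-b) :=
      mul_nonneg (Real.rpow_nonneg (neg_nonneg.2 hb) q) (neg_nonneg.2 hb)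
    have h1 : 0 ≤ a ^ q * a := by positivity
    rw [abs_of_nonpos (by linarith), abs_of_nonpos (by linarith)]
    calc _ = (-b) ^ q * (-b) + a ^ q * a := by ring
      _ ≤ _ := h
      _ = _ := by ring
  · rw [abs_of_nonpos ha, abs_of_nonneg hb]
    have h := hopp (-a) b (neg_nonneg.2 ha) hb
    have h0 : 0 ≤ (-a) ^ q * (-a) :=
      mul_nonneg (Real.rpow_nonneg (neg_nonneg.2 ha) q) (neg_nonneg.2 ha)
    have h1 : 0 ≤ b ^ q * b := by positivity
    rw [abs_of_nonneg (by linarith), abs_of_nonneg (by linarith)]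
    calc _ = b ^ q * b + (-a) ^ q * (-a) := by ring
      _ ≤ _ := h
      _ = _ := by ring
  · rw [abs_of_nonpos ha, abs_of_nonpos hb]
    have h := hnn (-a) (-b) (neg_nonneg.2 ha) (neg_nonneg.2 hb)
    rw [show b - a = -(-b - -a) by ring, abs_neg,
      show (-b) ^ q * b - (-a) ^ q * a = -((-b) ^ q * -b - (-a) ^ q * -a) by ring, abs_neg]
    exact h

/-- Second-order expansion of `|s + x| ^ r` for `r ≥ 2`. -/
theorem abs_add_rpow_le {r : ℝ} (hr : 2 ≤ r) (s x : ℝ) :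
    |s + x| ^ r ≤ |s| ^ r + r * (|s| ^ (r - 2) * s) * x +
      r * (r - 1) * (|s| + |x|) ^ (r - 2) * x ^ 2 := by
  have hconv : ConvexOn ℝ Set.univ (fun y : ℝ => |y| ^ r) := by
    have hsub : (fun y : ℝ => |y|) '' Set.univ ⊆ Set.Ici 0 := by
      rintro _ ⟨y, -, rfl⟩
      exact abs_nonneg y
    have habs : ConvexOn ℝ Set.univ (fun y : ℝ => |y|) := convexOn_univ_norm (E := ℝ)
    refine ConvexOn.comp (g := fun y : ℝ => y ^ r) ?_ habs ?_
    · refine (convexOn_rpow (by linarith)).subset hsub ?_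
      exact ((isPreconnected_univ.image _ continuous_abs.continuousOn).ordConnected).convex
    · exact fun a ha b _ hab => Real.rpow_le_rpow (hsub ha) hab (by linarith)
  -- The tangent is taken at s + x, so convexity gives an upper bound. Moving the derivative back to
  -- s costs the quadratic term, through the Lipschitz estimate; no second derivative is needed.
  have htan : |s + x| ^ r ≤ |s| ^ r + r * |s + x| ^ (r - 2) * (s + x) * x := by
    have hd := hasDerivAt_abs_rpow (s + x) (p := r) (by linarith)
    rcases lt_trichotomy x 0 with hx | hx | hx
    · have := hconv.le_slope_of_hasDerivAt (x := s + x) (y := s) trivial trivial (by linarith) hd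
      rw [slope_def_field, le_div_iff₀ (by linarith)] at this
      nlinarith
    · simp [hx]
    · have := hconv.slope_le_of_hasDerivAt (x := s) (y := s + x) trivial trivial (by linarith) hd
      rw [slope_def_field, div_le_iff₀ (by linarith)] at this
      nlinarith
  have hlip := abs_signed_rpow_sub_le (q := r - 2) (by linarith) s (s + x)
  rw [add_sub_cancel_left] at hlip
  have hmax : (max |s| |s + x|) ^ (r - 2) ≤ (|s| + |x|) ^ (r - 2) :=
    Real.rpow_le_rpow (by positivity)
      (max_le (by linarith [abs_nonneg x]) (abs_add_le s x)) (by linarith)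
  have h1 : (|s + x| ^ (r - 2) * (s + x) - |s| ^ (r - 2) * s) * x ≤
      (r - 1) * (|s| + |x|) ^ (r - 2) * x ^ 2 := by
    calc _ ≤ |(|s + x| ^ (r - 2) * (s + x) - |s| ^ (r - 2) * s)| * |x| := by
          rw [← abs_mul]; exact le_abs_self _
      _ ≤ ((r - 2 + 1) * (max |s| |s + x|) ^ (r - 2) * |x|) * |x| := by gcongr
      _ = (r - 1) * (max |s| |s + x|) ^ (r - 2) * x ^ 2 := by rw [← sq_abs x]; ring
      _ ≤ _ := by
          have : 0 ≤ r - 1 := by linarith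
          gcongr
  have h2 := mul_le_mul_of_nonneg_left h1 (by linarith : 0 ≤ r)
  nlinarith

/-- A second-order expansion of `|s + x| ^ r` in which the error is controlled by
`(1 + |s| ^ r) * (x ^ 2 + |x| ^ r)`. -/
theorem one_add_abs_add_rpow_le {r : ℝ} (hr : 2 ≤ r) (s x : ℝ) :
    1 + |s + x| ^ r ≤ 1 + |s| ^ r + r * (|s| ^ (r - 2) * s) * x +
      (r * (r - 1) * 2 ^ (r - 2)) * ((1 + |s| ^ r) * (x ^ 2 + |x| ^ r)) := by
  have h := abs_add_rpow_le hr s x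
  have hq : 0 ≤ r - 2 := by linarith
  have h1 : (|s| + |x|) ^ (r - 2) ≤ 2 ^ (r - 2) * (|s| ^ (r - 2) + |x| ^ (r - 2)) := by
    rw [mul_add]
    rcases le_total |s| |x| with hsx | hsx
    · calc (|s| + |x|) ^ (r - 2) ≤ (2 * |x|) ^ (r - 2) :=
            Real.rpow_le_rpow (by positivity) (by linarith) hq
        _ = 2 ^ (r - 2) * |x| ^ (r - 2) := Real.mul_rpow (by norm_num) (abs_nonneg _)
        _ ≤ _ := le_add_of_nonneg_left (by positivity)
    · calc (|s| + |x|) ^ (r - 2) ≤ (2 * |s|) ^ (r - 2) :=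
            Real.rpow_le_rpow (by positivity) (by linarith) hq
        _ = 2 ^ (r - 2) * |s| ^ (r - 2) := Real.mul_rpow (by norm_num) (abs_nonneg _)
        _ ≤ _ := le_add_of_nonneg_right (by positivity)
  -- The added 1 covers |s| ≤ 1. The error thus becomes a multiple of 1 + |s|^r itself, so the
  -- estimate can be iterated as a product.
  have h2 : |s| ^ (r - 2) ≤ 1 + |s| ^ r := by
    rcases le_total |s| 1 with hs | hs
    · have := Real.rpow_le_one (abs_nonneg s) hs hq
      have : 0 ≤ |s| ^ r := by positivity
      linarith
    · have := Real.rpow_le_rpow_of_exponent_le hs (by linarith : r - 2 ≤ r)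
      linarith
  have h3 : |x| ^ (r - 2) * x ^ 2 = |x| ^ r := by
    rcases eq_or_ne x 0 with rfl | hx
    · simp [Real.zero_rpow (by linarith : r ≠ 0)]
    · rw [← sq_abs, ← Real.rpow_natCast, ← Real.rpow_add (abs_pos.2 hx)]
      norm_num
  have h4 : (|s| + |x|) ^ (r - 2) * x ^ 2 ≤ 2 ^ (r - 2) * ((1 + |s| ^ r) * (x ^ 2 + |x| ^ r)) := by
    calc _ ≤ 2 ^ (r - 2) * (|s| ^ (r - 2) + |x| ^ (r - 2)) * x ^ 2 := by gcongr
      _ = 2 ^ (r - 2) * (|s| ^ (r - 2) * x ^ 2 + |x| ^ r) := by rw [← h3]; ring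
      _ ≤ 2 ^ (r - 2) * ((1 + |s| ^ r) * x ^ 2 + (1 + |s| ^ r) * |x| ^ r) := by
          have : 0 ≤ |s| ^ r := by positivity
          have h5 : 0 ≤ |x| ^ r := by positivity
          gcongr
          nlinarith
      _ = _ := by ring
  have h6 : 0 ≤ r * (r - 1) := mul_nonneg (by linarith) (by linarith)
  have h7 := mul_le_mul_of_nonneg_left h4 h6
  linarith

/-! ### Moments of sums of independent variables and almost sure convergence -/

section Moments

variable {Ω : Type*} [MeasurableSpace Ω] {μ : Measure Ω}

theorem memLp_of_integrable_abs_rpow {r : ℝ} (hr : 0 < r) {X : Ω → ℝ} (hX : Measurable X)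
    (h : Integrable (fun ω => |X ω| ^ r) μ) : MemLp X (ENNReal.ofReal r) μ := by
  rw [← integrable_norm_rpow_iff hX.aestronglyMeasurable (by simpa using hr) (by simp)]
  simpa [ENNReal.toReal_ofReal hr.le] using h

/-- A sequence whose `r`-th absolute moments are summable converges to zero almost surely. -/
theorem ae_tendsto_zero_of_summable_moment {r : ℝ} (hr : 0 < r) {Z : ℕ → Ω → ℝ} {b : ℕ → ℝ}
    (hZ : ∀ᶠ m in atTop, Integrable (fun ω => |Z m ω| ^ r) μ ∧ ∫ ω, |Z m ω| ^ r ∂μ ≤ b m)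
    (hb : Summable b) : ∀ᵐ ω ∂μ, Tendsto (fun m => Z m ω) atTop (𝓝 0) := by
  obtain ⟨M, hM⟩ := eventually_atTop.1 hZ
  -- By Tonelli the sum of the |Z m|^r has finite expectation, so it is almost surely finite and its
  -- terms tend to 0. The shift by M discards the indices without a bound.
  have hfin : ∫⁻ ω, ∑' m, ENNReal.ofReal (|Z (m + M) ω| ^ r) ∂μ ≠ ⊤ := by
    rw [lintegral_tsum fun m =>
      (hM (m + M) (Nat.le_add_left M m)).1.aestronglyMeasurable.aemeasurable.ennreal_ofReal]
    have hle : ∀ m, ∫⁻ ω, ENNReal.ofReal (|Z (m + M) ω| ^ r) ∂μ ≤ ENNReal.ofReal (b (m + M)) := by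
      intro m
      have h := hM (m + M) (Nat.le_add_left M m)
      rw [← ofReal_integral_eq_lintegral_ofReal h.1 (ae_of_all _ fun ω => by positivity)]
      exact ENNReal.ofReal_le_ofReal h.2
    refine ne_top_of_le_ne_top ?_ (ENNReal.tsum_le_tsum hle)
    exact ((summable_nat_add_iff M).2 hb).tsum_ofReal_ne_top
  have hae := ae_lt_top' (AEMeasurable.tsum fun m =>
      (hM (m + M) (Nat.le_add_left M m)).1.aestronglyMeasurable.aemeasurable.ennreal_ofReal) hfin
  filter_upwards [hae] with ω hω
  have h1 := ENNReal.tendsto_atTop_zero_of_tsum_ne_top hω.ne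
  have h2 : Tendsto (fun m => |Z (m + M) ω| ^ r) atTop (𝓝 0) := by
    have := (ENNReal.tendsto_toReal ENNReal.zero_ne_top).comp h1
    refine this.congr fun m => ?_
    exact ENNReal.toReal_ofReal (by positivity)
  have h3 : Tendsto (fun m => (|Z (m + M) ω| ^ r) ^ (1 / r)) atTop (𝓝 0) := by
    have := h2.rpow_const (p := 1 / r) (Or.inr (by positivity))
    rwa [Real.zero_rpow (by positivity)] at this
  rw [← tendsto_add_atTop_iff_nat M, tendsto_zero_iff_abs_tendsto_zero]
  refine h3.congr fun m => ?_
  rw [← Real.rpow_mul (abs_nonneg _), mul_one_div_cancel hr.ne', Real.rpow_one]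
  rfl

variable [IsProbabilityMeasure μ]

theorem integrable_abs_rpow_of_memLp {r q : ℝ} (hq : 0 < q) (hqr : q ≤ r) {X : Ω → ℝ}
    (h : MemLp X (ENNReal.ofReal r) μ) : Integrable (fun ω => |X ω| ^ q) μ := by
  have h' := h.mono_exponent (ENNReal.ofReal_le_ofReal hqr)
  have := h'.integrable_norm_rpow (by simpa using hq) (by simp)
  simpa [ENNReal.toReal_ofReal hq.le] using this

/-- Adding an independent centered variable to `S` multiplies `1 + 𝔼|S|^r` by at most
`1 + c * (𝔼 X² + 𝔼|X|^r)`. -/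
theorem one_add_integral_abs_add_rpow_le {r : ℝ} (hr : 2 ≤ r) {S X : Ω → ℝ}
    (hS : MemLp S (ENNReal.ofReal r) μ) (hX : MemLp X (ENNReal.ofReal r) μ)
    (hSX : IndepFun S X μ) (hX0 : ∫ ω, X ω ∂μ = 0) :
    1 + ∫ ω, |S ω + X ω| ^ r ∂μ ≤ (1 + ∫ ω, |S ω| ^ r ∂μ) *
      (1 + r * (r - 1) * 2 ^ (r - 2) * (∫ ω, X ω ^ 2 ∂μ + ∫ ω, |X ω| ^ r ∂μ)) := by
  have hr0 : 0 < r := by linarith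
  set c := r * (r - 1) * 2 ^ (r - 2) with hc
  have iSX : Integrable (fun ω => |S ω + X ω| ^ r) μ :=
    integrable_abs_rpow_of_memLp hr0 le_rfl (hS.add hX)
  have iS := integrable_abs_rpow_of_memLp hr0 le_rfl hS
  have iX := integrable_abs_rpow_of_memLp hr0 le_rfl hX
  have iX2 : Integrable (fun ω => X ω ^ 2) μ := by
    have := integrable_abs_rpow_of_memLp (q := 2) (by norm_num) hr hX
    simpa using this
  have iX1 : Integrable X μ := by
    have := integrable_abs_rpow_of_memLp (q := 1) (by norm_num) (by linarith) hX
    rw [← integrable_norm_iff hX.aestronglyMeasurable]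
    simpa using this
  have mg : Measurable (fun s : ℝ => r * (|s| ^ (r - 2) * s)) := by fun_prop
  have ig : Integrable (fun ω => r * (|S ω| ^ (r - 2) * S ω)) μ := by
    have h1 := integrable_abs_rpow_of_memLp (q := r - 1) (by linarith) (by linarith) hS
    refine (h1.const_mul r).mono' ?_ (ae_of_all _ fun ω => ?_)
    · exact (mg.comp_aemeasurable hS.aestronglyMeasurable.aemeasurable).aestronglyMeasurable
    · have : |S ω| ^ (r - 1) = |S ω| ^ (r - 2) * |S ω| := by
        rw [← Real.rpow_add_one' (abs_nonneg _) (by linarith)]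
        congr 1
        ring
      rw [this, Real.norm_eq_abs, abs_mul, abs_mul, abs_of_pos hr0,
        abs_of_nonneg (Real.rpow_nonneg (abs_nonneg _) _)]
  -- The first independence makes the linear term vanish, X being centered; the second factors the
  -- expectation of the error term.
  have hind1 : IndepFun (fun ω => r * (|S ω| ^ (r - 2) * S ω)) X μ :=
    hSX.comp mg measurable_id
  have hind2 : IndepFun (fun ω => 1 + |S ω| ^ r) (fun ω => X ω ^ 2 + |X ω| ^ r) μ :=
    hSX.comp (φ := fun s : ℝ => 1 + |s| ^ r) (ψ := fun x : ℝ => x ^ 2 + |x| ^ r)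
      (by fun_prop) (by fun_prop)
  have iS' : Integrable (fun ω => 1 + |S ω| ^ r) μ := (integrable_const 1).add iS
  have iX' : Integrable (fun ω => X ω ^ 2 + |X ω| ^ r) μ := iX2.add iX
  have i1 := hind1.integrable_mul ig iX1
  have i2 := hind2.integrable_mul iS' iX'
  have e1 := hind1.integral_mul_eq_mul_integral ig.aestronglyMeasurable iX1.aestronglyMeasurable
  have e2 := hind2.integral_mul_eq_mul_integral iS'.aestronglyMeasurable iX'.aestronglyMeasurable
  have key : ∫ ω, (1 + |S ω + X ω| ^ r) ∂μ ≤ ∫ ω, ((1 + |S ω| ^ r) +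
      ((fun ω => r * (|S ω| ^ (r - 2) * S ω)) * X) ω +
      c * ((fun ω => 1 + |S ω| ^ r) * (fun ω => X ω ^ 2 + |X ω| ^ r)) ω) ∂μ := by
    refine integral_mono ((integrable_const 1).add iSX) ((iS'.add i1).add (i2.const_mul c)) ?_
    intro ω
    exact one_add_abs_add_rpow_le hr (S ω) (X ω)
  have iS1 : Integrable (fun ω => (1 + |S ω| ^ r) +
      ((fun ω => r * (|S ω| ^ (r - 2) * S ω)) * X) ω) μ := iS'.add i1
  rw [integral_add (integrable_const 1) iSX, integral_add iS1 (i2.const_mul c),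
    integral_add iS' i1, integral_const_mul, e1, e2, hX0, integral_add (integrable_const 1) iS,
    integral_add iX2 iX] at key
  simp only [integral_const, probReal_univ, smul_eq_mul, one_mul, mul_zero, add_zero] at key
  linarith

/-- A Rosenthal-type inequality: weighted sums of independent centered variables with `r`-th
moments at most `K`, for `r ≥ 2` and weights in the unit ball of `ℓ²`, have `r`-th moments bounded
by a constant depending only on `r` and `K`. -/
theorem integral_abs_weighted_sum_rpow_le {r K : ℝ} (hr : 2 ≤ r) {ι : Type*} [Fintype ι]
    {X : ι → Ω → ℝ} (hmeas : ∀ i, Measurable (X i)) (hind : iIndepFun X μ)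
    (hmean : ∀ i, ∫ ω, X i ω ∂μ = 0) (hint : ∀ i, Integrable (fun ω => |X i ω| ^ r) μ)
    (hK : ∀ i, ∫ ω, |X i ω| ^ r ∂μ ≤ K) {u : ι → ℝ} (hu : ∑ i, u i ^ 2 ≤ 1) :
    Integrable (fun ω => |∑ i, u i * X i ω| ^ r) μ ∧
      ∫ ω, |∑ i, u i * X i ω| ^ r ∂μ ≤
        Real.exp (r * (r - 1) * 2 ^ (r - 2) * (1 + 2 * K)) := by
  classical
  have hr0 : 0 < r := by linarith
  -- K ≥ 0 is read off from one of the moments, hence needs an index.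
  rcases isEmpty_or_nonempty ι with hι | ⟨⟨i₀⟩⟩
  · simp [Real.zero_rpow hr0.ne', Real.exp_nonneg]
  have hK0 : 0 ≤ K := le_trans (integral_nonneg fun ω => by positivity) (hK i₀)
  have hL : ∀ i, MemLp (fun ω => u i * X i ω) (ENNReal.ofReal r) μ := fun i =>
    (memLp_of_integrable_abs_rpow hr0 (hmeas i) (hint i)).const_mul (u i)
  have hLs : ∀ s : Finset ι, MemLp (fun ω => ∑ i ∈ s, u i * X i ω) (ENNReal.ofReal r) μ :=
    fun s => memLp_finsetSum s fun i _ => hL i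
  have hind' : iIndepFun (fun i ω => u i * X i ω) μ :=
    hind.comp (fun i x => u i * x) fun i => measurable_const_mul (u i)
  set c := r * (r - 1) * 2 ^ (r - 2) with hc
  have hc0 : 0 ≤ c := mul_nonneg (mul_nonneg (by linarith) (by linarith)) (by positivity)
  have hu1 : ∀ i, |u i| ≤ 1 := fun i => by
    have h1 : u i ^ 2 ≤ 1 :=
      (Finset.single_le_sum (f := fun i => u i ^ 2) (fun i _ => sq_nonneg (u i))
        (Finset.mem_univ i)).trans hu
    exact (sq_le_one_iff_abs_le_one _).1 h1
  -- 1 + 2K is (1 + K) + K: x² ≤ 1 + |x|^r bounds the second moment by 1 + K, and |u i| ≤ 1 gives |u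
  -- i|^r ≤ u i².
  have hmom : ∀ i, ∫ ω, (u i * X i ω) ^ 2 ∂μ + ∫ ω, |u i * X i ω| ^ r ∂μ ≤
      (1 + 2 * K) * u i ^ 2 := by
    intro i
    have i2 : Integrable (fun ω => X i ω ^ 2) μ := by
      simpa using integrable_abs_rpow_of_memLp (q := 2) (by norm_num) hr
        (memLp_of_integrable_abs_rpow hr0 (hmeas i) (hint i))
    have h2 : ∫ ω, X i ω ^ 2 ∂μ ≤ 1 + K := by
      calc ∫ ω, X i ω ^ 2 ∂μ ≤ ∫ ω, (1 + |X i ω| ^ r) ∂μ := by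
            refine integral_mono i2 ((integrable_const 1).add (hint i)) fun ω => ?_
            have h0 : 0 ≤ |X i ω| ^ r := by positivity
            change X i ω ^ 2 ≤ 1 + |X i ω| ^ r
            rw [← sq_abs]
            rcases le_total |X i ω| 1 with h | h
            · have : |X i ω| ^ 2 ≤ 1 := pow_le_one₀ (abs_nonneg _) h
              linarith
            · have := Real.rpow_le_rpow_of_exponent_le h hr
              rw [Real.rpow_two] at this
              linarith
        _ = 1 + ∫ ω, |X i ω| ^ r ∂μ := by
            rw [integral_add (integrable_const 1) (hint i)]
            simp
        _ ≤ 1 + K := by linarith [hK i]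
    have h3 : |u i| ^ r ≤ u i ^ 2 := by
      rw [← sq_abs, ← Real.rpow_two]
      rcases (abs_nonneg (u i)).eq_or_lt with h | h
      · rw [← h, Real.zero_rpow hr0.ne', Real.zero_rpow two_ne_zero]
      · exact Real.rpow_le_rpow_of_exponent_ge h (hu1 i) hr
    have h4 : ∫ ω, |u i * X i ω| ^ r ∂μ = |u i| ^ r * ∫ ω, |X i ω| ^ r ∂μ := by
      rw [← integral_const_mul]
      congr 1
      ext ω
      rw [abs_mul, Real.mul_rpow (abs_nonneg _) (abs_nonneg _)]
    simp only [mul_pow]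
    rw [integral_const_mul, h4]
    have h5 : |u i| ^ r * ∫ ω, |X i ω| ^ r ∂μ ≤ u i ^ 2 * K :=
      mul_le_mul h3 (hK i) (integral_nonneg fun ω => by positivity) (sq_nonneg _)
    nlinarith [sq_nonneg (u i)]
  -- Adding one summand at a time multiplies the bound by a factor 1 + O(u i²); as ∑ u i² ≤ 1, the
  -- full product is at most an exponential independent of the number of summands.
  have hprod : ∀ s : Finset ι, 1 + ∫ ω, |∑ i ∈ s, u i * X i ω| ^ r ∂μ ≤
      ∏ i ∈ s, (1 + c * ((1 + 2 * K) * u i ^ 2)) := by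
    intro s
    induction s using Finset.induction_on with
    | empty => simp [Real.zero_rpow hr0.ne']
    | insert i s hi ih =>
      have hindS : IndepFun (fun ω => ∑ j ∈ s, u j * X j ω) (fun ω => u i * X i ω) μ := by
        have := hind'.indepFun_finsetSum_of_notMem
          (fun j => (hmeas j).const_mul (u j)) hi
        convert this using 1
        ext ω
        simp
      have hstep := one_add_integral_abs_add_rpow_le hr (hLs s) (hL i) hindS
        (by rw [integral_const_mul, hmean, mul_zero])
      rw [Finset.prod_insert hi, mul_comm]
      simp only [Finset.sum_insert hi]
      simp only [add_comm (u i * X i _)]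
      refine hstep.trans ?_
      have h0 : 0 ≤ ∫ ω, |∑ i ∈ s, u i * X i ω| ^ r ∂μ := integral_nonneg fun ω => by positivity
      refine mul_le_mul ih ?_ ?_ (le_trans (by linarith) ih)
      · gcongr
        exact hmom i
      · have h1 : 0 ≤ ∫ ω, (u i * X i ω) ^ 2 ∂μ := integral_nonneg fun ω => by positivity
        have h2 : 0 ≤ ∫ ω, |u i * X i ω| ^ r ∂μ := integral_nonneg fun ω => by positivity
        positivity
  refine ⟨integrable_abs_rpow_of_memLp hr0 le_rfl (hLs Finset.univ), ?_⟩
  have h1 : ∏ i, (1 + c * ((1 + 2 * K) * u i ^ 2)) ≤ Real.exp (c * (1 + 2 * K)) := by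
    calc _ ≤ ∏ i, Real.exp (c * ((1 + 2 * K) * u i ^ 2)) := by
          refine Finset.prod_le_prod (fun i _ => by positivity) fun i _ => ?_
          linarith [Real.add_one_le_exp (c * ((1 + 2 * K) * u i ^ 2))]
      _ = Real.exp (c * (1 + 2 * K) * ∑ i, u i ^ 2) := by
          rw [← Real.exp_sum, Finset.mul_sum]
          congr 1
          exact Finset.sum_congr rfl fun i _ => by ring
      _ ≤ _ := by
          refine Real.exp_le_exp.2 (mul_le_of_le_one_right (by positivity) hu)
  linarith [hprod Finset.univ]

/-- Independence of a doubly indexed family yields independence of its rows. -/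
theorem iIndepFun_curry {ι κ : Type*} [Countable ι] [Countable κ] {X : ι × κ → Ω → ℝ}
    (hX : ∀ i, Measurable (X i)) (h : iIndepFun X μ) :
    iIndepFun (fun i ω j => X (i, j) ω) μ := by
  have hP : ∀ i j, IsProbabilityMeasure (μ.map (X (i, j))) := fun i j =>
    Measure.isProbabilityMeasure_map (hX _).aemeasurable
  -- Independence is read as a statement on joint laws; currying a product measure over pairs gives
  -- the product of the row laws.
  rw [iIndepFun_iff_map_fun_eq_infinitePi_map (by fun_prop)]
  have h1 := (iIndepFun_iff_map_fun_eq_infinitePi_map hX).1 h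
  have h2 : ∀ i, μ.map (fun ω j => X (i, j) ω) = Measure.infinitePi fun j => μ.map (X (i, j)) :=
    fun i => (iIndepFun_iff_map_fun_eq_infinitePi_map (fun j => hX (i, j))).1
      (h.precomp (g := fun j => (i, j)) fun a b hab => (Prod.mk.inj hab).2)
  simp_rw [h2]
  rw [← Measure.infinitePi_map_curry (fun i j => μ.map (X (i, j)))]
  rw [← h1, Measure.map_map (by fun_prop) (by fun_prop)]
  rfl

end Moments

/-! ### Moment bounds for linear and quadratic forms in the noise -/

/-- Noise matrices with jointly independent, centered, unit variance entries whose absolute moments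
of order `r` are at most `K`. -/
structure IsNoise {Ω : Type*} [MeasurableSpace Ω] (μ : Measure Ω) (r K : ℝ) {n m p : ℕ}
    (E : Fin n → Ω → Matrix (Fin m) (Fin p) ℝ) : Prop where
  measurable : ∀ k i j, Measurable fun ω => E k ω i j
  indep : iIndepFun (fun (t : Fin n × Fin m × Fin p) (ω : Ω) => E t.1 ω t.2.1 t.2.2) μ
  mean : ∀ k i j, ∫ ω, E k ω i j ∂μ = 0
  second_moment : ∀ k i j, ∫ ω, E k ω i j ^ 2 ∂μ = 1
  integrable : ∀ k i j, Integrable (fun ω => |E k ω i j| ^ r) μ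
  moment_le : ∀ k i j, ∫ ω, |E k ω i j| ^ r ∂μ ≤ K

/-- The constant in the Rosenthal-type bound `integral_abs_weighted_sum_rpow_le`. -/
noncomputable def rosenthalConst (r K : ℝ) : ℝ :=
  Real.exp (r * (r - 1) * 2 ^ (r - 2) * (1 + 2 * K))

theorem rosenthalConst_pos (r K : ℝ) : 0 < rosenthalConst r K := Real.exp_pos _

theorem trace_mul_transpose_eq_sum {m p : ℕ} (X Y : Matrix (Fin m) (Fin p) ℝ) :
    (X * Y.transpose).trace = ∑ i, ∑ j, X i j * Y i j := by
  simp [Matrix.trace, Matrix.mul_apply]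

section Noise

variable {Ω : Type*} [MeasurableSpace Ω] {μ : Measure Ω} [IsProbabilityMeasure μ]
  {r K : ℝ} {n m p : ℕ} {E : Fin n → Ω → Matrix (Fin m) (Fin p) ℝ}

theorem IsNoise.integral_mul (hE : IsNoise μ r K E) (hr : 2 ≤ r) (k l : Fin n) (a b : Fin m)
    (j : Fin p) : Integrable (fun ω => E k ω a j * E l ω b j) μ ∧
      ∫ ω, E k ω a j * E l ω b j ∂μ = if k = l ∧ a = b then 1 else 0 := by
  have h2 : ∀ k i, MemLp (fun ω => E k ω i j) 2 μ := fun k i => by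
    have := memLp_of_integrable_abs_rpow (by linarith) (hE.measurable k i j) (hE.integrable k i j)
    refine this.mono_exponent ?_
    rw [← ENNReal.ofReal_ofNat]
    exact ENNReal.ofReal_le_ofReal hr
  refine ⟨(h2 k a).integrable_mul (h2 l b), ?_⟩
  split_ifs with h
  · obtain ⟨rfl, rfl⟩ := h
    simpa [pow_two] using hE.second_moment k a j
  · have hne : (k, a, j) ≠ (l, b, j) := fun h' => h (by simpa using h')
    have := (hE.indep.indepFun hne).integral_mul_eq_mul_integral
      (hE.measurable k a j).aestronglyMeasurable (hE.measurable l b j).aestronglyMeasurable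
    refine this.trans ?_
    simp [hE.mean]

/-- Moment bound for a linear form in the entries of one transformed noise matrix. -/
theorem IsNoise.linear_form_moment (hE : IsNoise μ r K E) (hr : 4 ≤ r) (hp : 0 < p)
    (R : Matrix (Fin m) (Fin m) ℝ) (B : Matrix (Fin m) (Fin p) ℝ) (k : Fin n) :
    Integrable (fun ω => |(B * (R * E k ω).transpose).trace /
        √(p * ((∑ i, ∑ a, R i a ^ 2) * (B * B.transpose).trace))| ^ r) μ ∧
      ∫ ω, |(B * (R * E k ω).transpose).trace /
        √(p * ((∑ i, ∑ a, R i a ^ 2) * (B * B.transpose).trace))| ^ r ∂μ ≤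
        rosenthalConst r K * (p : ℝ) ^ (-(r / 4)) := by
  set τ := ∑ i, ∑ a, R i a ^ 2 with hτ
  set b := (B * B.transpose).trace with hb
  have hbsum : b = ∑ i, ∑ j, B i j ^ 2 := by
    rw [hb, trace_mul_transpose_eq_sum]
    simp only [pow_two]
  have hτ0 : 0 ≤ τ := by positivity
  have hb0 : 0 ≤ b := by rw [hbsum]; positivity
  have hp0 : (0 : ℝ) < p := by exact_mod_cast hp
  -- tr(B (RE)ᵀ) is the inner product of RᵀB with E, and Cauchy–Schwarz gives ‖RᵀB‖² ≤ ‖R‖²‖B‖² in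
  -- Frobenius norm. If the normalization is 0, division by zero makes all weights 0.
  let u : Fin m × Fin p → ℝ := fun t => (R.transpose * B) t.1 t.2 / √(τ * b)
  have hu : ∑ t, u t ^ 2 ≤ 1 := by
    have h1 : ∑ t : Fin m × Fin p, ((R.transpose * B) t.1 t.2) ^ 2 ≤ τ * b := by
      rw [Fintype.sum_prod_type]
      calc ∑ i, ∑ j, ((R.transpose * B) i j) ^ 2
          ≤ ∑ i, ∑ j, (∑ a, R a i ^ 2) * ∑ a, B a j ^ 2 := by
            refine Finset.sum_le_sum fun i _ => Finset.sum_le_sum fun j _ => ?_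
            rw [Matrix.mul_apply]
            exact Finset.sum_mul_sq_le_sq_mul_sq _ _ _
        _ = (∑ i, ∑ a, R a i ^ 2) * ∑ j, ∑ a, B a j ^ 2 := by
            rw [Finset.sum_mul_sum]
        _ = τ * b := by
            rw [hbsum, hτ]
            congr 1 <;> exact Finset.sum_comm
    simp only [u, div_pow, Real.sq_sqrt (mul_nonneg hτ0 hb0)]
    rw [← Finset.sum_div]
    exact div_le_one_of_le₀ h1 (mul_nonneg hτ0 hb0)
  have hform : ∀ ω, (B * (R * E k ω).transpose).trace / √(p * (τ * b)) =
      (√p)⁻¹ * ∑ t, u t * E k ω t.1 t.2 := by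
    intro ω
    have e1 : (B * (R * E k ω).transpose).trace =
        ∑ t : Fin m × Fin p, (R.transpose * B) t.1 t.2 * E k ω t.1 t.2 := by
      have e2 : (B * (R * E k ω).transpose).trace =
          ((R.transpose * B) * (E k ω).transpose).trace := by
        rw [Matrix.transpose_mul, ← Matrix.mul_assoc, Matrix.trace_mul_comm, ← Matrix.mul_assoc]
      rw [e2, trace_mul_transpose_eq_sum]
      exact (Fintype.sum_prod_type' fun i j => (R.transpose * B) i j * E k ω i j).symm
    rw [e1, Real.sqrt_mul hp0.le]
    simp only [u, div_mul_eq_mul_div, ← Finset.sum_div]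
    rw [div_mul_eq_div_div, div_right_comm, div_eq_mul_inv _ (√p), mul_comm]
  obtain ⟨h1, h2⟩ := integral_abs_weighted_sum_rpow_le (μ := μ) (r := r) (K := K) (by linarith)
    (X := fun (t : Fin m × Fin p) ω => E k ω t.1 t.2) (fun t => hE.measurable k t.1 t.2)
    (hE.indep.precomp (g := fun t : Fin m × Fin p => (k, t.1, t.2))
      fun s t h => by simpa [Prod.ext_iff] using h)
    (fun t => hE.mean k t.1 t.2) (fun t => hE.integrable k t.1 t.2)
    (fun t => hE.moment_le k t.1 t.2) hu
  have hpow : ∀ ω, |(B * (R * E k ω).transpose).trace / √(p * (τ * b))| ^ r =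
      (√p)⁻¹ ^ r * |∑ t, u t * E k ω t.1 t.2| ^ r := by
    intro ω
    rw [hform, abs_mul, Real.mul_rpow (abs_nonneg _) (abs_nonneg _), abs_of_nonneg (by positivity)]
  simp only [hpow]
  refine ⟨h1.const_mul _, ?_⟩
  rw [integral_const_mul, mul_comm]
  refine mul_le_mul h2 ?_ (by positivity) (rosenthalConst_pos r K).le
  rw [Real.sqrt_eq_rpow, ← Real.rpow_neg hp0.le, ← Real.rpow_mul hp0.le]
  -- The true rate p^(-r/2) is weakened to that of the quadratic forms, so that one summable bound
  -- serves both.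
  exact Real.rpow_le_rpow_of_exponent_le (by exact_mod_cast hp) (by linarith)

/-- Moment bound for the normalized inner product of two transformed noise columns. -/
theorem IsNoise.column_form_moment (hE : IsNoise μ r K E) (hr : 4 ≤ r)
    (R : Matrix (Fin m) (Fin m) ℝ) (hR : 0 < ∑ i, ∑ a, R i a ^ 2) (k l : Fin n) (j : Fin p) :
    Integrable (fun ω => |(∑ i, (R * E k ω) i j * (R * E l ω) i j) /
        ∑ i, ∑ a, R i a ^ 2| ^ (r / 2)) μ ∧
      ∫ ω, |(∑ i, (R * E k ω) i j * (R * E l ω) i j) / ∑ i, ∑ a, R i a ^ 2| ^ (r / 2) ∂μ ≤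
        rosenthalConst r K := by
  set τ := ∑ i, ∑ a, R i a ^ 2 with hτ
  let ν : Fin m → ℝ := fun i => ∑ a, R i a ^ 2
  have hν : ∀ i, 0 ≤ ν i := fun i => Finset.sum_nonneg fun a _ => sq_nonneg _
  let u : Fin m → Fin m → ℝ := fun i a => R i a / √(ν i)
  have hu : ∀ i, ∑ a, u i a ^ 2 ≤ 1 := fun i => by
    simp only [u, div_pow, Real.sq_sqrt (hν i)]
    rw [← Finset.sum_div]
    exact div_self_le_one (ν i)
  -- A row with ν i = 0 is itself zero, so the convention for division by zero is harmless.
  have hRu : ∀ i a, R i a = √(ν i) * u i a := fun i a => by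
    rcases (hν i).eq_or_lt with h | h
    · have h0 : R i a ^ 2 = 0 :=
        (Finset.sum_eq_zero_iff_of_nonneg fun a _ => sq_nonneg (R i a)).1 h.symm a
          (Finset.mem_univ a)
      simp [u, pow_eq_zero_iff two_ne_zero |>.1 h0]
    · exact (mul_div_cancel₀ _ (Real.sqrt_pos.2 h).ne').symm
  let x : Fin n → Fin m → Ω → ℝ := fun k i ω => ∑ a, u i a * E k ω a j
  have hx : ∀ k i ω, (R * E k ω) i j = √(ν i) * x k i ω := fun k i ω => by
    rw [Matrix.mul_apply, Finset.mul_sum]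
    exact Finset.sum_congr rfl fun a _ => by rw [hRu, mul_assoc]
  have hmom : ∀ k i, Integrable (fun ω => |x k i ω| ^ r) μ ∧
      ∫ ω, |x k i ω| ^ r ∂μ ≤ rosenthalConst r K := fun k i =>
    integral_abs_weighted_sum_rpow_le (μ := μ) (r := r) (K := K) (by linarith)
      (X := fun a ω => E k ω a j) (fun a => hE.measurable k a j)
      (hE.indep.precomp (g := fun a : Fin m => (k, a, j)) fun s t h => by simpa using h)
      (fun a => hE.mean k a j) (fun a => hE.integrable k a j)
      (fun a => hE.moment_le k a j) (hu i)
  have hw : ∑ i, ν i / τ = 1 := by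
    rw [← Finset.sum_div]
    exact div_self hR.ne'
  -- The entries of a column of RE are dependent in general. The normalized inner product is a
  -- convex combination with weights ν i / τ, so Jensen for the power r/2 ≥ 1 suffices, followed by
  -- |xy|^(r/2) ≤ (|x|^r + |y|^r)/2.
  have hbound : ∀ ω, |(∑ i, (R * E k ω) i j * (R * E l ω) i j) / τ| ^ (r / 2) ≤
      ∑ i, ν i / τ * ((|x k i ω| ^ r + |x l i ω| ^ r) / 2) := by
    intro ω
    have e : (∑ i, (R * E k ω) i j * (R * E l ω) i j) / τ =
        ∑ i, ν i / τ * (x k i ω * x l i ω) := by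
      rw [Finset.sum_div]
      refine Finset.sum_congr rfl fun i _ => ?_
      rw [hx, hx, mul_mul_mul_comm, Real.mul_self_sqrt (hν i)]
      ring
    rw [e]
    calc |∑ i, ν i / τ * (x k i ω * x l i ω)| ^ (r / 2)
        ≤ (∑ i, ν i / τ * |x k i ω * x l i ω|) ^ (r / 2) := by
          refine Real.rpow_le_rpow (abs_nonneg _) ?_ (by linarith)
          refine (Finset.abs_sum_le_sum_abs _ _).trans_eq (Finset.sum_congr rfl fun i _ => ?_)
          rw [abs_mul, abs_of_nonneg (div_nonneg (hν i) hR.le)]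
      _ ≤ ∑ i, ν i / τ * |x k i ω * x l i ω| ^ (r / 2) :=
          Real.rpow_arith_mean_le_arith_mean_rpow _ _ _
            (fun i _ => div_nonneg (hν i) hR.le) hw (fun i _ => abs_nonneg _) (by linarith)
      _ ≤ _ := by
          refine Finset.sum_le_sum fun i _ =>
            mul_le_mul_of_nonneg_left ?_ (div_nonneg (hν i) hR.le)
          have hsq : ∀ y : ℝ, |y| ^ r = (|y| ^ (r / 2)) ^ 2 := fun y => by
            rw [← Real.rpow_mul_natCast (abs_nonneg _)]
            congr 1
            push_cast
            ring
          rw [abs_mul, Real.mul_rpow (abs_nonneg _) (abs_nonneg _), hsq, hsq]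
          nlinarith [sq_nonneg (|x k i ω| ^ (r / 2) - |x l i ω| ^ (r / 2))]
  have hterm : ∀ i, Integrable (fun ω => ν i / τ * ((|x k i ω| ^ r + |x l i ω| ^ r) / 2)) μ :=
    fun i => (((hmom k i).1.add (hmom l i).1).div_const 2).const_mul _
  have hint : Integrable
      (fun ω => ∑ i, ν i / τ * ((|x k i ω| ^ r + |x l i ω| ^ r) / 2)) μ :=
    integrable_finsetSum _ fun i _ => hterm i
  have hmeasE : ∀ k i, Measurable fun ω => (R * E k ω) i j := fun k i => by
    simp only [Matrix.mul_apply]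
    exact Finset.measurable_sum _ fun a _ => (hE.measurable k a j).const_mul _
  have hmeas : Measurable fun ω =>
      |(∑ i, (R * E k ω) i j * (R * E l ω) i j) / τ| ^ (r / 2) :=
    (((Finset.measurable_sum Finset.univ fun i _ =>
      (hmeasE k i).mul (hmeasE l i)).div_const τ).norm).pow_const (r / 2)
  have hI : Integrable (fun ω =>
      |(∑ i, (R * E k ω) i j * (R * E l ω) i j) / τ| ^ (r / 2)) μ := by
    refine hint.mono' hmeas.aestronglyMeasurable (ae_of_all _ fun ω => ?_)
    rw [Real.norm_eq_abs, abs_of_nonneg (by positivity)]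
    exact hbound ω
  refine ⟨hI, (integral_mono hI hint hbound).trans ?_⟩
  rw [integral_finsetSum _ fun i _ => hterm i]
  calc _ ≤ ∑ i, ν i / τ * rosenthalConst r K := by
        refine Finset.sum_le_sum fun i _ => ?_
        rw [integral_const_mul, integral_div, integral_add (hmom k i).1 (hmom l i).1]
        refine mul_le_mul_of_nonneg_left ?_ (div_nonneg (hν i) hR.le)
        linarith [(hmom k i).2, (hmom l i).2]
    _ = _ := by rw [← Finset.sum_mul, hw, one_mul]

/-- Distinct noise entries are orthonormal, so only k = l, a = b survives in the expansion. This
supplies the centering of the column terms. -/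
theorem IsNoise.integral_column_form (hE : IsNoise μ r K E) (hr : 4 ≤ r)
    (R : Matrix (Fin m) (Fin m) ℝ) (k l : Fin n) (j : Fin p) :
    Integrable (fun ω => ∑ i, (R * E k ω) i j * (R * E l ω) i j) μ ∧
      ∫ ω, ∑ i, (R * E k ω) i j * (R * E l ω) i j ∂μ =
        if k = l then ∑ i, ∑ a, R i a ^ 2 else 0 := by
  have e : ∀ ω, ∑ i, (R * E k ω) i j * (R * E l ω) i j =
      ∑ i, ∑ a, ∑ b, (R i a * R i b) * (E k ω a j * E l ω b j) := fun ω => by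
    refine Finset.sum_congr rfl fun i _ => ?_
    rw [Matrix.mul_apply, Matrix.mul_apply, Finset.sum_mul_sum]
    exact Finset.sum_congr rfl fun a _ => Finset.sum_congr rfl fun b _ => by ring
  have hI : ∀ i a b, Integrable (fun ω => (R i a * R i b) * (E k ω a j * E l ω b j)) μ :=
    fun i a b => (hE.integral_mul (by linarith) k l a b j).1.const_mul _
  have hI1 : ∀ i a, Integrable (fun ω => ∑ b, (R i a * R i b) * (E k ω a j * E l ω b j)) μ :=
    fun i a => integrable_finsetSum _ fun b _ => hI i a b
  have hI2 : ∀ i, Integrable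
      (fun ω => ∑ a, ∑ b, (R i a * R i b) * (E k ω a j * E l ω b j)) μ :=
    fun i => integrable_finsetSum _ fun a _ => hI1 i a
  simp only [e]
  refine ⟨integrable_finsetSum _ fun i _ => hI2 i, ?_⟩
  rw [integral_finsetSum _ fun i _ => hI2 i]
  simp only [integral_finsetSum _ fun a _ => hI1 _ a, integral_finsetSum _ fun b _ => hI _ _ b,
    integral_const_mul, (hE.integral_mul (by linarith : 2 ≤ r) k l _ _ j).2]
  by_cases h : k = l
  · simp [h, pow_two]
  · simp [h]

/-- Moment bound for the normalized, centered inner product of two transformed noise matrices. -/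
theorem IsNoise.quadratic_form_moment (hE : IsNoise μ r K E) (hr : 4 ≤ r) (hp : 0 < p)
    (R : Matrix (Fin m) (Fin m) ℝ) (hR : 0 < ∑ i, ∑ a, R i a ^ 2) (k l : Fin n) :
    Integrable (fun ω => |((R * E k ω) * (R * E l ω).transpose).trace /
        (p * ∑ i, ∑ a, R i a ^ 2) - (if k = l then 1 else 0)| ^ (r / 2)) μ ∧
      ∫ ω, |((R * E k ω) * (R * E l ω).transpose).trace /
        (p * ∑ i, ∑ a, R i a ^ 2) - (if k = l then 1 else 0)| ^ (r / 2) ∂μ ≤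
        rosenthalConst (r / 2) (2 ^ (r / 2) * (rosenthalConst r K + 1)) *
          (p : ℝ) ^ (-(r / 4)) := by
  set τ := ∑ i, ∑ a, R i a ^ 2 with hτ
  set δ : ℝ := if k = l then 1 else 0 with hδ
  have hp0 : (0 : ℝ) < p := by exact_mod_cast hp
  let Y : Fin p → Ω → ℝ := fun j ω => (∑ i, (R * E k ω) i j * (R * E l ω) i j) / τ - δ
  have hmeasE : ∀ k i j, Measurable fun ω => (R * E k ω) i j := fun k i j => by
    simp only [Matrix.mul_apply]
    exact Finset.measurable_sum _ fun a _ => (hE.measurable k a j).const_mul _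
  have hYmeas : ∀ j, Measurable (Y j) := fun j =>
    ((Finset.measurable_sum Finset.univ fun i _ =>
      (hmeasE k i j).mul (hmeasE l i j)).div_const τ).sub_const δ
  -- The entries are reindexed with the column first; Y j depends only on the block of entries in
  -- column j.
  have hYind : iIndepFun Y μ := by
    have h1 : iIndepFun (fun (t : Fin p × (Fin n × Fin m)) (ω : Ω) => E t.2.1 ω t.2.2 t.1) μ :=
      hE.indep.precomp (g := fun t : Fin p × (Fin n × Fin m) => (t.2.1, t.2.2, t.1))
        fun s t h => by
          simp only [Prod.mk.injEq] at h
          exact Prod.ext h.2.2 (Prod.ext h.1 h.2.1)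
    have h2 := iIndepFun_curry (fun t => hE.measurable _ _ _) h1
    have h3 := h2.comp (fun _ (v : Fin n × Fin m → ℝ) =>
      (∑ i, (∑ a, R i a * v (k, a)) * (∑ a, R i a * v (l, a))) / τ - δ) (fun _ => by fun_prop)
    exact h3
  have hYmean : ∀ j, ∫ ω, Y j ω ∂μ = 0 := fun j => by
    obtain ⟨h1, h2⟩ := hE.integral_column_form hr R k l j
    rw [integral_sub (h1.div_const τ) (integrable_const δ), integral_div, h2]
    by_cases h : k = l
    · simp [hδ, h, ← hτ, div_self hR.ne']
    · simp [hδ, h]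
  have hYmom : ∀ j, Integrable (fun ω => |Y j ω| ^ (r / 2)) μ ∧
      ∫ ω, |Y j ω| ^ (r / 2) ∂μ ≤ 2 ^ (r / 2) * (rosenthalConst r K + 1) := fun j => by
    obtain ⟨h1, h2⟩ := hE.column_form_moment hr R hR k l j
    have hle : ∀ ω, |Y j ω| ^ (r / 2) ≤ 2 ^ (r / 2) *
        (|(∑ i, (R * E k ω) i j * (R * E l ω) i j) / τ| ^ (r / 2) + 1) := fun ω => by
      set y := (∑ i, (R * E k ω) i j * (R * E l ω) i j) / τ
      have hδ1 : |δ| ≤ 1 := by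
        rw [hδ]
        split_ifs <;> simp
      have hy : |y - δ| ≤ 2 * max |y| 1 := by
        have := abs_sub y δ
        linarith [le_max_left |y| 1, le_max_right |y| 1]
      calc |y - δ| ^ (r / 2) ≤ (2 * max |y| 1) ^ (r / 2) :=
            Real.rpow_le_rpow (abs_nonneg _) hy (by linarith)
        _ = 2 ^ (r / 2) * (max |y| 1) ^ (r / 2) := Real.mul_rpow (by norm_num) (by positivity)
        _ ≤ _ := by
            gcongr
            have : 0 ≤ |y| ^ (r / 2) := by positivity
            rcases max_choice |y| 1 with h | h <;> rw [h]
            · linarith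
            · rw [Real.one_rpow]
              linarith
    have hdom := (h1.add (integrable_const (1 : ℝ))).const_mul (2 ^ (r / 2))
    have hI : Integrable (fun ω => |Y j ω| ^ (r / 2)) μ := by
      refine hdom.mono' ?_ (ae_of_all _ fun ω => ?_)
      · exact ((hYmeas j).norm.pow_const (r / 2)).aestronglyMeasurable
      · rw [Real.norm_eq_abs, abs_of_nonneg (by positivity)]
        exact hle ω
    refine ⟨hI, (integral_mono hI hdom hle).trans ?_⟩
    simp only [Pi.add_apply]
    rw [integral_const_mul, integral_add h1 (integrable_const 1)]
    simp only [integral_const, probReal_univ, smul_eq_mul, one_mul]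
    gcongr
  -- The average is (√p)⁻¹ times a sum with unit-ball weights (√p)⁻¹; the outer factor to the power
  -- r/2 yields p^(-r/4).
  let u : Fin p → ℝ := fun _ => (√p)⁻¹
  have hu : ∑ j, u j ^ 2 ≤ 1 := by
    simp [u, inv_pow, Real.sq_sqrt hp0.le, mul_inv_cancel₀ hp0.ne']
  obtain ⟨h1, h2⟩ := integral_abs_weighted_sum_rpow_le (μ := μ) (r := r / 2)
    (by linarith) hYmeas hYind hYmean (fun j => (hYmom j).1) (fun j => (hYmom j).2) hu
  have hform : ∀ ω, ((R * E k ω) * (R * E l ω).transpose).trace / (p * τ) - δ =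
      (√p)⁻¹ * ∑ j, u j * Y j ω := by
    intro ω
    simp only [u, Y]
    rw [← Finset.mul_sum, ← mul_assoc, ← mul_inv, Real.mul_self_sqrt hp0.le,
      Finset.sum_sub_distrib, ← Finset.sum_div, trace_mul_transpose_eq_sum, Finset.sum_comm]
    simp only [Finset.sum_const, Finset.card_univ, Fintype.card_fin, nsmul_eq_mul]
    field_simp
  have hpow : ∀ ω, |((R * E k ω) * (R * E l ω).transpose).trace / (p * τ) - δ| ^ (r / 2) =
      (√p)⁻¹ ^ (r / 2) * |∑ j, u j * Y j ω| ^ (r / 2) := by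
    intro ω
    rw [hform, abs_mul, Real.mul_rpow (abs_nonneg _) (abs_nonneg _), abs_of_nonneg (by positivity)]
  simp only [hpow]
  refine ⟨h1.const_mul _, ?_⟩
  rw [integral_const_mul, mul_comm]
  refine mul_le_mul h2 ?_ (by positivity) (rosenthalConst_pos _ _).le
  rw [Real.sqrt_eq_rpow, ← Real.rpow_neg hp0.le, ← Real.rpow_mul hp0.le]
  refine le_of_eq ?_
  congr 1
  ring

end Noise

/-! ### Algebra of the normalized trace form and of the estimators -/

section Algebra

variable {n m p : ℕ}

theorem normTrace_comm (X Y : Matrix (Fin m) (Fin p) ℝ) : normTrace X Y = normTrace Y X := by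
  simp only [normTrace, trace_mul_transpose_eq_sum, mul_comm]

theorem normTrace_add_left (X Y Z : Matrix (Fin m) (Fin p) ℝ) :
    normTrace (X + Y) Z = normTrace X Z + normTrace Y Z := by
  simp only [normTrace, Matrix.add_mul, Matrix.trace_add, mul_add]

theorem normTrace_sub_left (X Y Z : Matrix (Fin m) (Fin p) ℝ) :
    normTrace (X - Y) Z = normTrace X Z - normTrace Y Z := by
  simp only [normTrace, Matrix.sub_mul, Matrix.trace_sub, mul_sub]

theorem normTrace_smul_left (a : ℝ) (X Y : Matrix (Fin m) (Fin p) ℝ) :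
    normTrace (a • X) Y = a * normTrace X Y := by
  simp only [normTrace, Matrix.smul_mul, Matrix.trace_smul, smul_eq_mul]
  ring

theorem normTrace_add_right (X Y Z : Matrix (Fin m) (Fin p) ℝ) :
    normTrace X (Y + Z) = normTrace X Y + normTrace X Z := by
  rw [normTrace_comm, normTrace_add_left, normTrace_comm Y, normTrace_comm Z]

theorem normTrace_sub_right (X Y Z : Matrix (Fin m) (Fin p) ℝ) :
    normTrace X (Y - Z) = normTrace X Y - normTrace X Z := by
  rw [normTrace_comm, normTrace_sub_left, normTrace_comm Y, normTrace_comm Z]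

theorem normTrace_smul_right (a : ℝ) (X Y : Matrix (Fin m) (Fin p) ℝ) :
    normTrace X (a • Y) = a * normTrace X Y := by
  rw [normTrace_comm, normTrace_smul_left, normTrace_comm]

theorem normTrace_sampleMean_right (X : Matrix (Fin m) (Fin p) ℝ)
    (W : Fin n → Matrix (Fin m) (Fin p) ℝ) :
    normTrace X (sampleMean W) = 1 / (n : ℝ) * ∑ k, normTrace X (W k) := by
  rw [sampleMean, normTrace_smul_right]
  simp only [normTrace, Matrix.transpose_sum, Matrix.mul_sum, Matrix.trace_sum, Finset.mul_sum]

theorem normTrace_sampleMean_left (X : Matrix (Fin m) (Fin p) ℝ)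
    (W : Fin n → Matrix (Fin m) (Fin p) ℝ) :
    normTrace (sampleMean W) X = 1 / (n : ℝ) * ∑ k, normTrace (W k) X := by
  rw [normTrace_comm, normTrace_sampleMean_right]
  simp only [normTrace_comm X]

theorem normTrace_self_nonneg (X : Matrix (Fin m) (Fin p) ℝ) : 0 ≤ normTrace X X := by
  rw [normTrace, trace_mul_transpose_eq_sum]
  exact mul_nonneg (by positivity)
    (Finset.sum_nonneg fun i _ => Finset.sum_nonneg fun j _ => mul_self_nonneg _)

theorem normTrace_ones (hm : 0 < m) (hp : 0 < p) :
    normTrace (onesMatrix m p) (onesMatrix m p) = 1 := by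
  have hm' : (m : ℝ) ≠ 0 := by exact_mod_cast hm.ne'
  have hp' : (p : ℝ) ≠ 0 := by exact_mod_cast hp.ne'
  rw [normTrace, trace_mul_transpose_eq_sum]
  simp [onesMatrix]
  field_simp

/-- `A` with the mean of its entries subtracted from every entry. -/
noncomputable def centered (A : Matrix (Fin m) (Fin p) ℝ) : Matrix (Fin m) (Fin p) ℝ :=
  A - normTrace A (onesMatrix m p) • onesMatrix m p

theorem normTrace_centered_self (hm : 0 < m) (hp : 0 < p) (A : Matrix (Fin m) (Fin p) ℝ) :
    normTrace (centered A) (centered A) =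
      normTrace A A - normTrace A (onesMatrix m p) ^ 2 := by
  rw [centered, normTrace_sub_left, normTrace_sub_right, normTrace_sub_right, normTrace_smul_left,
    normTrace_smul_left, normTrace_smul_right, normTrace_smul_right, normTrace_ones hm hp,
    normTrace_comm (onesMatrix m p) A]
  ring

theorem sampleMean_add_left (hn : 0 < n) (A : Matrix (Fin m) (Fin p) ℝ)
    (W : Fin n → Matrix (Fin m) (Fin p) ℝ) :
    sampleMean (fun k => A + W k) = A + sampleMean W := by
  have hn' : (n : ℝ) ≠ 0 := by exact_mod_cast hn.ne'
  rw [sampleMean, sampleMean, Finset.sum_add_distrib, smul_add, Finset.sum_const,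
    Finset.card_univ, Fintype.card_fin, ← Nat.cast_smul_eq_nsmul ℝ, smul_smul,
    one_div_mul_cancel hn', one_smul]

theorem pooledEstimator_eq_sum_normTrace (X : Fin n → Matrix (Fin m) (Fin p) ℝ) :
    pooledEstimator X = 1 / ((n : ℝ) - 1) *
      ∑ k, normTrace (X k - sampleMean X) (X k - sampleMean X) := by
  simp only [pooledEstimator, normTrace, ← Finset.mul_sum]
  rw [← mul_assoc]
  congr 1
  rw [one_div_mul_one_div, mul_assoc]

/-- The common signal cancels in every deviation from the sample mean; what remains is the variance
identity ∑‖W_k − W̄‖² = ∑‖W_k‖² − ‖∑ W_k‖²/n. -/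
theorem pooledEstimator_add_left (hn : 0 < n) (A : Matrix (Fin m) (Fin p) ℝ)
    (W : Fin n → Matrix (Fin m) (Fin p) ℝ) :
    pooledEstimator (fun k => A + W k) = 1 / ((n : ℝ) - 1) *
      (∑ k, normTrace (W k) (W k) - 1 / (n : ℝ) * ∑ k, ∑ l, normTrace (W k) (W l)) := by
  have hn' : (n : ℝ) ≠ 0 := by exact_mod_cast hn.ne'
  rw [pooledEstimator_eq_sum_normTrace, sampleMean_add_left hn]
  simp only [add_sub_add_left_eq_sub]
  congr 1
  simp only [normTrace_sub_left, normTrace_sub_right, normTrace_sampleMean_right,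
    normTrace_sampleMean_left, Finset.sum_sub_distrib, ← Finset.mul_sum, Finset.sum_const,
    Finset.card_univ, Fintype.card_fin, nsmul_eq_mul]
  rw [Finset.sum_comm (f := fun k l => normTrace (W l) (W k))]
  field_simp
  ring

theorem alphaHat_eq (X : Fin n → Matrix (Fin m) (Fin p) ℝ) :
    alphaHat X = 1 - pooledEstimator X / n / hatDenominator X := by
  rw [alphaHat, pooledEstimator]
  -- With n - 1 as an atom, `ring` can split the inverse of the product.
  generalize (n : ℝ) - 1 = d
  congr 2
  ring

/-- The cross terms 2⟨A, W̄⟩ and −2⟨A, U⟩⟨U, W̄⟩ combine into 2⟨C, W̄⟩ with C = `centered A`. Hence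
the linear error scales with the standard deviation of the entries of A rather than with their size.
-/
theorem hatDenominator_add_left (hn : 0 < n) (A : Matrix (Fin m) (Fin p) ℝ)
    (W : Fin n → Matrix (Fin m) (Fin p) ℝ) :
    hatDenominator (fun k => A + W k) =
      (normTrace A A - normTrace A (onesMatrix m p) ^ 2) +
        2 * (1 / (n : ℝ) * ∑ k, normTrace (centered A) (W k)) +
        1 / (n : ℝ) * ∑ k, (1 / (n : ℝ) * ∑ l, normTrace (W k) (W l)) -
        (1 / (n : ℝ) * ∑ k, normTrace (onesMatrix m p) (W k)) ^ 2 := by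
  rw [hatDenominator, sampleMean_add_left hn]
  simp only [← normTrace_sampleMean_right]
  rw [← normTrace_sampleMean_left]
  simp only [centered, normTrace_add_left, normTrace_add_right, normTrace_sub_left,
    normTrace_smul_left]
  rw [normTrace_comm (sampleMean W) A, normTrace_comm (sampleMean W) (onesMatrix m p)]
  ring

theorem sum_sq_sqrt_eq_trace {S : Matrix (Fin m) (Fin m) ℝ} (hS : S.PosDef) :
    ∑ i, ∑ a, CFC.sqrt S i a ^ 2 = S.trace := by
  have h1 : CFC.sqrt S * CFC.sqrt S = S := CFC.sqrt_mul_sqrt_self S hS.posSemidef.nonneg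
  have h2 : (CFC.sqrt S).transpose = CFC.sqrt S := by
    have := (Matrix.nonneg_iff_posSemidef.1 (CFC.sqrt_nonneg S)).isHermitian
    rwa [Matrix.IsHermitian, Matrix.conjTranspose_eq_transpose_of_trivial] at this
  have h3 := trace_mul_transpose_eq_sum (CFC.sqrt S) (CFC.sqrt S)
  rw [h2, h1] at h3
  rw [h3]
  simp only [pow_two]

/-- Rescaling of the normalized linear form to a normalized trace. -/
theorem normTrace_eq_sqrt_mul (hm : 0 < m) (hp : 0 < p) {τ : ℝ} (hτ : 0 < τ)
    (B W : Matrix (Fin m) (Fin p) ℝ) :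
    normTrace B W = √(1 / (m : ℝ) * τ * normTrace B B) *
      ((B * W.transpose).trace / √(p * (τ * (B * B.transpose).trace))) := by
  have hm' : (0 : ℝ) < m := by exact_mod_cast hm
  have hp' : (0 : ℝ) < p := by exact_mod_cast hp
  have hb : 0 ≤ (B * B.transpose).trace := by
    rw [trace_mul_transpose_eq_sum]
    exact Finset.sum_nonneg fun i _ => Finset.sum_nonneg fun j _ => mul_self_nonneg _
  rcases hb.eq_or_lt with h | h
  · have hB : B = 0 := by
      rw [trace_mul_transpose_eq_sum] at h
      ext i j
      have h1 := (Finset.sum_eq_zero_iff_of_nonneg fun i _ =>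
        Finset.sum_nonneg fun j _ => mul_self_nonneg (B i j)).1 h.symm i (Finset.mem_univ i)
      have h2 := (Finset.sum_eq_zero_iff_of_nonneg fun j _ =>
        mul_self_nonneg (B i j)).1 h1 j (Finset.mem_univ j)
      exact mul_self_eq_zero.1 h2
    simp [hB, normTrace]
  · set b := (B * B.transpose).trace with hbdef
    have e : √(1 / (m : ℝ) * τ * normTrace B B) = √(p * (τ * b)) / (m * p) := by
      have e' : 1 / (m : ℝ) * τ * normTrace B B = p * (τ * b) / (m * p) ^ 2 := by
        rw [normTrace, ← hbdef]
        field_simp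
      rw [e', Real.sqrt_div' _ (by positivity), Real.sqrt_sq (by positivity)]
    have hs : √(p * (τ * b)) ≠ 0 := (Real.sqrt_pos.2 (by positivity)).ne'
    rw [e, normTrace]
    field_simp

end Algebra

/-! ### Deterministic limits -/

section Limits

theorem tendsto_bounded_mul_zero {b f : ℕ → ℝ} {C : ℝ} (hb : ∀ᶠ m in atTop, |b m| ≤ C)
    (hf : Tendsto f atTop (𝓝 0)) : Tendsto (fun m => b m * f m) atTop (𝓝 0) := by
  refine squeeze_zero_norm' (a := fun m => C * |f m|) ?_ ?_
  · filter_upwards [hb] with m hm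
    rw [Real.norm_eq_abs, abs_mul]
    exact mul_le_mul_of_nonneg_right hm (abs_nonneg _)
  · simpa using hf.abs.const_mul C

/-- The deterministic limit argument: `t` is the noise level, `v` the variance of the entries of the
signal, `a` their mean; the estimators are perturbations of the oracle quantities whose errors are
small relative to `v + t / n`. -/
theorem plugin_limits {n : ℝ} (hn : 1 ≤ n) {t v a ρ ξ s η D : ℕ → ℝ} {T A₀ : ℝ}
    (ht : ∀ᶠ m in atTop, 0 < t m) (hv : ∀ᶠ m in atTop, 0 ≤ v m)
    (hT : ∀ᶠ m in atTop, t m ≤ T) (ha : ∀ᶠ m in atTop, |a m| ≤ A₀)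
    (hρ : Tendsto ρ atTop (𝓝 1)) (hξ : Tendsto ξ atTop (𝓝 0))
    (hs : Tendsto s atTop (𝓝 (1 / n))) (hη : Tendsto η atTop (𝓝 0))
    (hD : ∀ᶠ m in atTop, D m = v m + 2 * (√(t m * v m) * ξ m) + t m * s m -
      (√(t m) * η m) ^ 2) :
    Tendsto (fun m => t m * ρ m - t m) atTop (𝓝 0) ∧ (∀ᶠ m in atTop, D m ≠ 0) ∧
      Tendsto (fun m => t m * ρ m / n / D m - t m / n / (v m + t m / n)) atTop (𝓝 0) ∧
      Tendsto (fun m => t m * ρ m / n / D m * (a m + √(t m) * η m) -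
        t m / n / (v m + t m / n) * a m) atTop (𝓝 0) := by
  have hn0 : 0 < n := by linarith
  -- The oracle denominator. It has no positive lower bound, so every error is measured relative to
  -- it.
  let G : ℕ → ℝ := fun m => v m + t m / n
  have hG : ∀ᶠ m in atTop, 0 < G m ∧ t m ≤ n * G m ∧ v m ≤ G m := by
    filter_upwards [ht, hv] with m htm hvm
    have h1 : 0 < t m / n := by positivity
    refine ⟨by simp only [G]; linarith, ?_, by simp only [G]; linarith⟩
    have : n * G m = n * v m + t m := by simp only [G]; field_simp
    rw [this]
    have : 0 ≤ n * v m := by positivity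
    linarith
  -- t ≤ nG and v ≤ G give tv ≤ nG² ≤ ((n + 1)G)².
  have hb1 : ∀ᶠ m in atTop, |√(t m * v m) / G m| ≤ n + 1 := by
    filter_upwards [hG, ht, hv] with m ⟨hGm, h1, h2⟩ htm hvm
    rw [abs_of_nonneg (by positivity), div_le_iff₀ hGm, Real.sqrt_le_left (by positivity)]
    nlinarith [mul_le_mul h1 h2 hvm (by positivity)]
  have hb2 : ∀ᶠ m in atTop, |t m / G m| ≤ n := by
    filter_upwards [hG, ht] with m ⟨hGm, h1, h2⟩ htm
    rw [abs_of_nonneg (by positivity), div_le_iff₀ hGm]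
    exact h1
  have hγ : ∀ᶠ m in atTop, |t m / n / G m| ≤ 1 := by
    filter_upwards [hG, ht] with m ⟨hGm, h1, h2⟩ htm
    rw [abs_of_nonneg (by positivity), div_le_iff₀ hGm, div_le_iff₀ hn0]
    linarith
  have hst : ∀ᶠ m in atTop, |√(t m)| ≤ √T := by
    filter_upwards [hT] with m hm
    rw [abs_of_nonneg (Real.sqrt_nonneg _)]
    exact Real.sqrt_le_sqrt hm
  -- D/G = 1 + 2(√(tv)/G)ξ + (t/G)(s − 1/n − η²), each coefficient being bounded.
  have hκ : Tendsto (fun m => D m / G m) atTop (𝓝 1) := by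
    have h1 := (tendsto_bounded_mul_zero hb1 hξ).const_mul 2
    have hs' : Tendsto (fun m => s m - 1 / n - η m ^ 2) atTop (𝓝 0) := by
      have := (hs.sub_const (1 / n)).sub (hη.pow 2)
      simpa using this
    have h2 := tendsto_bounded_mul_zero hb2 hs'
    have h3 := (h1.add h2).const_add 1
    simp only [mul_zero, add_zero] at h3
    refine h3.congr' ?_
    filter_upwards [hG, hD, ht] with m ⟨hGm, _, _⟩ hDm htm
    rw [hDm, mul_pow, Real.sq_sqrt htm.le, eq_div_iff hGm.ne']
    have : G m = v m + t m / n := rfl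
    field_simp
    rw [this]
    field_simp
    ring
  have hD0 : ∀ᶠ m in atTop, D m ≠ 0 := by
    filter_upwards [hκ.eventually_ne one_ne_zero] with m hm h
    exact hm (by rw [h, zero_div])
  have hratio : Tendsto (fun m => ρ m / (D m / G m)) atTop (𝓝 1) := by
    have := hρ.div hκ one_ne_zero
    rwa [div_one] at this
  have hratio' : Tendsto (fun m => ρ m / (D m / G m) - 1) atTop (𝓝 0) := by
    simpa using hratio.sub_const 1
  have heq : ∀ᶠ m in atTop, t m * ρ m / n / D m = t m / n / G m * (ρ m / (D m / G m)) := by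
    filter_upwards [hG, hD0] with m ⟨hGm, _, _⟩ hDm
    have := hGm.ne'
    field_simp
  refine ⟨?_, hD0, ?_, ?_⟩
  · have hρ' : Tendsto (fun m => ρ m - 1) atTop (𝓝 0) := by simpa using hρ.sub_const 1
    have hb : ∀ᶠ m in atTop, |t m| ≤ T := by
      filter_upwards [ht, hT] with m h1 h2
      rwa [abs_of_pos h1]
    refine (tendsto_bounded_mul_zero hb hρ').congr fun m => by ring
  · refine (tendsto_bounded_mul_zero hγ hratio').congr' ?_
    filter_upwards [heq] with m hm
    rw [hm]
    simp only [G]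
    ring
  -- The error splits into the relative error of the ratio times the bounded mean a, and the bounded
  -- ratio times the fluctuation √t η of the estimated mean.
  · have h1 := tendsto_bounded_mul_zero hγ (tendsto_bounded_mul_zero ha hratio')
    have h2 := hratio.mul (tendsto_bounded_mul_zero hst hη)
    rw [mul_zero] at h2
    have h3 := h1.add (tendsto_bounded_mul_zero hγ h2)
    rw [add_zero] at h3
    refine h3.congr' ?_
    filter_upwards [heq] with m hm
    rw [hm]
    simp only [G]
    ring

/-- If `m / p m` converges to a positive limit then, for `q > 1`, the sequence `p m ^ (-q)` is
eventually dominated by a summable one. -/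
theorem exists_summable_rpow_bound {p : ℕ → ℕ} {c : ℝ} (hc : 0 < c)
    (hp : Tendsto p atTop atTop)
    (hmp : Tendsto (fun m : ℕ => (m : ℝ) / (p m : ℝ)) atTop (𝓝 c)) {q : ℝ} (hq : 1 < q) :
    ∃ b : ℕ → ℝ, Summable b ∧ ∀ᶠ m in atTop, (p m : ℝ) ^ (-q) ≤ b m := by
  -- Eventually m < 2c p, whence p^(-q) ≤ (2c)^q m^(-q).
  refine ⟨fun m => (2 * c) ^ q * (m : ℝ) ^ (-q),
    (Real.summable_nat_rpow.2 (by linarith)).mul_left _, ?_⟩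
  filter_upwards [hmp.eventually_lt_const (by linarith : c < 2 * c), hp.eventually_gt_atTop 0,
    eventually_gt_atTop 0] with m h1 h2 h3
  have hp0 : (0 : ℝ) < p m := by exact_mod_cast h2
  have hm0 : (0 : ℝ) < m := by exact_mod_cast h3
  rw [div_lt_iff₀ hp0] at h1
  rw [Real.rpow_neg hp0.le, Real.rpow_neg hm0.le, ← div_eq_mul_inv, inv_eq_one_div,
    div_le_div_iff₀ (by positivity) (by positivity), one_mul, ← Real.mul_rpow (by positivity) hp0.le]
  exact Real.rpow_le_rpow hm0.le h1.le (by linarith)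

end Limits

end Shrinkage

/-! ### Strong consistency of the estimators -/

theorem lemma2 {Ω : Type*} [MeasurableSpace Ω] (μ : Measure Ω) [IsProbabilityMeasure μ]
    (n : ℕ) (hn : 2 ≤ n)
    (p : ℕ → ℕ) (c : ℝ) (hc : 0 < c)
    (hp : Tendsto p atTop atTop)
    (hmp : Tendsto (fun m : ℕ => (m : ℝ) / (p m : ℝ)) atTop (𝓝 c))
    (A : (m : ℕ) → Matrix (Fin m) (Fin (p m)) ℝ)
    (hA_nonneg : ∀ m i j, 0 ≤ A m i j)
    (hA_bdd : ∃ B : ℝ, ∀ m : ℕ,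
      1 / ((m : ℝ) * (p m : ℝ)) * (A m * (A m).transpose).trace ≤ B)
    (S : (m : ℕ) → Matrix (Fin m) (Fin m) ℝ)
    (hS_pos : ∀ m, (S m).PosDef)
    (hS_bdd : ∃ B : ℝ, ∀ m : ℕ, 1 / (m : ℝ) * (S m).trace ≤ B)
    (E : (m : ℕ) → Fin n → Ω → Matrix (Fin m) (Fin (p m)) ℝ)
    (hE_meas : ∀ m k i j, Measurable fun ω => E m k ω i j)
    (hE_indep : ∀ m, iIndepFun
      (fun (t : Fin n × Fin m × Fin (p m)) (ω : Ω) => E m t.1 ω t.2.1 t.2.2) μ)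
    (hE_ident : ∀ m k i j i' j',
      IdentDistrib (fun ω => E m k ω i j) (fun ω => E m k ω i' j') μ μ)
    (hE_mean : ∀ m k i j, ∫ ω, E m k ω i j ∂μ = 0)
    (hE_var : ∀ m k i j, variance (fun ω => E m k ω i j) μ = 1)
    (hE_moment : ∃ ε : ℝ, 0 < ε ∧ ∃ K : ℝ, ∀ m k i j,
      Integrable (fun ω => |E m k ω i j| ^ (4 + ε)) μ ∧
        ∫ ω, |E m k ω i j| ^ (4 + ε) ∂μ ≤ K) :
    (∀ᵐ ω ∂μ, Tendsto
      (fun m : ℕ => |Shrinkage.pooledEstimator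
          (fun k => Shrinkage.observation (A m) (S m) (E m k ω)) -
        1 / (m : ℝ) * (S m).trace|) atTop (𝓝 0)) ∧
    (∀ᵐ ω ∂μ, ∀ᶠ m : ℕ in atTop, Shrinkage.hatDenominator
      (fun k => Shrinkage.observation (A m) (S m) (E m k ω)) ≠ 0) ∧
    (∀ᵐ ω ∂μ, Tendsto
      (fun m : ℕ => |Shrinkage.alphaHat
          (fun k => Shrinkage.observation (A m) (S m) (E m k ω)) -
        Shrinkage.alphaOracle n (A m) (S m)|) atTop (𝓝 0)) ∧
    (∀ᵐ ω ∂μ, Tendsto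
      (fun m : ℕ => |Shrinkage.betaHat
          (fun k => Shrinkage.observation (A m) (S m) (E m k ω)) -
        Shrinkage.betaOracle n (A m) (S m)|) atTop (𝓝 0)) := by
  obtain ⟨ε, hε, K, hK⟩ := hE_moment
  obtain ⟨BA, hBA⟩ := hA_bdd
  obtain ⟨T, hT⟩ := hS_bdd
  have hn0 : 0 < n := by omega
  have hnR : (2 : ℝ) ≤ n := by exact_mod_cast hn
  have hnoise : ∀ m, Shrinkage.IsNoise μ (4 + ε) K (E m) := fun m =>
    { measurable := hE_meas m
      indep := hE_indep m
      mean := hE_mean m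
      second_moment := fun k i j => by
        rw [← hE_var m k i j]
        exact (variance_of_integral_eq_zero (hE_meas m k i j).aemeasurable (hE_mean m k i j)).symm
      integrable := fun k i j => (hK m k i j).1
      moment_le := fun k i j => (hK m k i j).2 }
  -- Here more than four moments are needed: the rate p^(-r/4) is summable because r/4 > 1.
  obtain ⟨b, hb, hpb⟩ := Shrinkage.exists_summable_rpow_bound hc hp hmp
    (by linarith : 1 < (4 + ε) / 4)
  have hpos : ∀ᶠ m in atTop, 0 < m ∧ 0 < p m ∧ 0 < (S m).trace := by
    filter_upwards [eventually_gt_atTop 0, hp.eventually_gt_atTop 0] with m h1 h2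
    have : Nonempty (Fin m) := ⟨⟨0, h1⟩⟩
    exact ⟨h1, h2, (hS_pos m).trace_pos⟩
  have hquad : ∀ᵐ ω ∂μ, ∀ k l, Tendsto (fun m =>
      ((CFC.sqrt (S m) * E m k ω) * (CFC.sqrt (S m) * E m l ω).transpose).trace /
        (p m * (S m).trace) - (if k = l then 1 else 0)) atTop (𝓝 0) := by
    rw [ae_all_iff]
    intro k
    rw [ae_all_iff]
    intro l
    refine Shrinkage.ae_tendsto_zero_of_summable_moment (r := (4 + ε) / 2) (by linarith) ?_
      (hb.mul_left (Shrinkage.rosenthalConst ((4 + ε) / 2)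
        (2 ^ ((4 + ε) / 2) * (Shrinkage.rosenthalConst (4 + ε) K + 1))))
    filter_upwards [hpos, hpb] with m ⟨_, h2, h3⟩ h4
    have hR := Shrinkage.sum_sq_sqrt_eq_trace (hS_pos m)
    have := (hnoise m).quadratic_form_moment (by linarith) h2 (CFC.sqrt (S m)) (by rwa [hR]) k l
    rw [hR] at this
    exact ⟨this.1, this.2.trans
      (mul_le_mul_of_nonneg_left h4 (Shrinkage.rosenthalConst_pos _ _).le)⟩
  have hlin : ∀ B : (m : ℕ) → Matrix (Fin m) (Fin (p m)) ℝ, ∀ᵐ ω ∂μ, ∀ k, Tendsto (fun m =>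
      (B m * (CFC.sqrt (S m) * E m k ω).transpose).trace /
        √(p m * ((S m).trace * (B m * (B m).transpose).trace))) atTop (𝓝 0) := by
    intro B
    rw [ae_all_iff]
    intro k
    refine Shrinkage.ae_tendsto_zero_of_summable_moment (r := 4 + ε) (by linarith) ?_
      (hb.mul_left (Shrinkage.rosenthalConst (4 + ε) K))
    filter_upwards [hpos, hpb] with m ⟨_, h2, h3⟩ h4
    have hR := Shrinkage.sum_sq_sqrt_eq_trace (hS_pos m)
    have := (hnoise m).linear_form_moment (by linarith) h2 (CFC.sqrt (S m)) (B m) k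
    rw [hR] at this
    exact ⟨this.1, this.2.trans
      (mul_le_mul_of_nonneg_left h4 (Shrinkage.rosenthalConst_pos _ _).le)⟩
  let t : ℕ → ℝ := fun m => 1 / (m : ℝ) * (S m).trace
  let a : ℕ → ℝ := fun m => Shrinkage.normTrace (A m) (Shrinkage.onesMatrix m (p m))
  let v : ℕ → ℝ := fun m => Shrinkage.normTrace (A m) (A m) - a m ^ 2
  have htpos : ∀ᶠ m in atTop, 0 < t m := by
    filter_upwards [hpos] with m ⟨h1, _, h3⟩
    have : (0 : ℝ) < m := by exact_mod_cast h1
    positivity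
  have hvnn : ∀ᶠ m in atTop, 0 ≤ v m := by
    filter_upwards [hpos] with m ⟨h1, h2, _⟩
    exact (Shrinkage.normTrace_self_nonneg _).trans_eq
      (Shrinkage.normTrace_centered_self h1 h2 (A m))
  -- v ≥ 0 says that the squared mean entry is at most the mean square.
  have habs : ∀ᶠ m in atTop, |a m| ≤ √BA := by
    filter_upwards [hvnn] with m hm
    refine Real.abs_le_sqrt ?_
    have h1 : Shrinkage.normTrace (A m) (A m) ≤ BA := hBA m
    have h2 : v m = Shrinkage.normTrace (A m) (A m) - a m ^ 2 := rfl
    linarith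
  -- The shrinkage claim is stated for 1 − α, which is the ratio of the noise level over n to the
  -- denominator, for the estimator and the oracle alike.
  have hmain : ∀ᵐ ω ∂μ,
      Tendsto (fun m : ℕ => Shrinkage.pooledEstimator
          (fun k => Shrinkage.observation (A m) (S m) (E m k ω)) - t m) atTop (𝓝 0) ∧
      (∀ᶠ m : ℕ in atTop, Shrinkage.hatDenominator
        (fun k => Shrinkage.observation (A m) (S m) (E m k ω)) ≠ 0) ∧
      Tendsto (fun m : ℕ => (1 - Shrinkage.alphaHat
          (fun k => Shrinkage.observation (A m) (S m) (E m k ω))) -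
        (1 - Shrinkage.alphaOracle n (A m) (S m))) atTop (𝓝 0) ∧
      Tendsto (fun m : ℕ => Shrinkage.betaHat
          (fun k => Shrinkage.observation (A m) (S m) (E m k ω)) -
        Shrinkage.betaOracle n (A m) (S m)) atTop (𝓝 0) := by
    filter_upwards [hquad, hlin fun m => Shrinkage.centered (A m),
      hlin fun m => Shrinkage.onesMatrix m (p m)] with ω hq hl hu
    let W : (m : ℕ) → Fin n → Matrix (Fin m) (Fin (p m)) ℝ := fun m k => CFC.sqrt (S m) * E m k ω
    let q : Fin n → Fin n → ℕ → ℝ := fun k l m =>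
      (W m k * (W m l).transpose).trace / (p m * (S m).trace)
    let lf : ((m : ℕ) → Matrix (Fin m) (Fin (p m)) ℝ) → Fin n → ℕ → ℝ := fun B k m =>
      (B m * (W m k).transpose).trace / √(p m * ((S m).trace * (B m * (B m).transpose).trace))
    have hq' : ∀ k l, Tendsto (q k l) atTop (𝓝 (if k = l then 1 else 0)) := fun k l => by
      have := (hq k l).add_const (if k = l then (1 : ℝ) else 0)
      simpa [q, W] using this
    have hqsum : Tendsto (fun m => ∑ k, ∑ l, q k l m) atTop (𝓝 n) := by
      have := tendsto_finsetSum Finset.univ fun k _ =>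
        tendsto_finsetSum Finset.univ fun l _ => hq' k l
      simpa using this
    have hqdiag : Tendsto (fun m => ∑ k, q k k m) atTop (𝓝 n) := by
      have := tendsto_finsetSum Finset.univ fun k _ => hq' k k
      simpa using this
    have hlf : ∀ B, (∀ k, Tendsto (lf B k) atTop (𝓝 0)) →
        Tendsto (fun m => 1 / (n : ℝ) * ∑ k, lf B k m) atTop (𝓝 0) := fun B hB => by
      have := (tendsto_finsetSum Finset.univ fun k _ => hB k).const_mul (1 / (n : ℝ))
      simpa using this
    -- The limit is (n − (1/n)·n)/(n − 1) = 1: both the diagonal sum and the full double sum tend to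
    -- n.
    have hρ : Tendsto (fun m => 1 / ((n : ℝ) - 1) *
        (∑ k, q k k m - 1 / (n : ℝ) * ∑ k, ∑ l, q k l m)) atTop (𝓝 1) := by
      have := (hqdiag.sub (hqsum.const_mul (1 / (n : ℝ)))).const_mul (1 / ((n : ℝ) - 1))
      rwa [one_div_mul_cancel (by linarith : (n : ℝ) ≠ 0),
        one_div_mul_cancel (by linarith : (n : ℝ) - 1 ≠ 0)] at this
    have hs : Tendsto (fun m => 1 / (n : ℝ) * (1 / (n : ℝ) * ∑ k, ∑ l, q k l m)) atTop
        (𝓝 (1 / (n : ℝ))) := by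
      have := (hqsum.const_mul (1 / (n : ℝ))).const_mul (1 / (n : ℝ))
      rwa [one_div_mul_cancel (by linarith : (n : ℝ) ≠ 0), mul_one] at this
    have hξ := hlf (fun m => Shrinkage.centered (A m)) hl
    have hη := hlf (fun m => Shrinkage.onesMatrix m (p m)) hu
    have hnt : ∀ᶠ m in atTop, ∀ k l, Shrinkage.normTrace (W m k) (W m l) = t m * q k l m := by
      filter_upwards [hpos] with m ⟨h1, h2, h3⟩ k l
      have h1' : (m : ℝ) ≠ 0 := by exact_mod_cast h1.ne'
      have h2' : (p m : ℝ) ≠ 0 := by exact_mod_cast h2.ne'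
      have h3' := h3.ne'
      simp only [Shrinkage.normTrace, t, q]
      field_simp
    have hcen : ∀ᶠ m in atTop, ∀ k, Shrinkage.normTrace (Shrinkage.centered (A m)) (W m k) =
        √(t m * v m) * lf (fun m => Shrinkage.centered (A m)) k m := by
      filter_upwards [hpos] with m ⟨h1, h2, h3⟩ k
      rw [Shrinkage.normTrace_eq_sqrt_mul h1 h2 h3, Shrinkage.normTrace_centered_self h1 h2]
    have hone : ∀ᶠ m in atTop, ∀ k,
        Shrinkage.normTrace (Shrinkage.onesMatrix m (p m)) (W m k) =
        √(t m) * lf (fun m => Shrinkage.onesMatrix m (p m)) k m := by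
      filter_upwards [hpos] with m ⟨h1, h2, h3⟩ k
      rw [Shrinkage.normTrace_eq_sqrt_mul h1 h2 h3, Shrinkage.normTrace_ones h1 h2, mul_one]
    have hpool : ∀ᶠ m in atTop, Shrinkage.pooledEstimator
        (fun k => Shrinkage.observation (A m) (S m) (E m k ω)) = t m * (1 / ((n : ℝ) - 1) *
        (∑ k, q k k m - 1 / (n : ℝ) * ∑ k, ∑ l, q k l m)) := by
      filter_upwards [hnt] with m hm
      refine (Shrinkage.pooledEstimator_add_left hn0 (A m) (W m)).trans ?_
      simp only [hm, ← Finset.mul_sum]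
      ring
    have hden : ∀ᶠ m in atTop, Shrinkage.hatDenominator
        (fun k => Shrinkage.observation (A m) (S m) (E m k ω)) = v m +
        2 * (√(t m * v m) *
          (1 / (n : ℝ) * ∑ k, lf (fun m => Shrinkage.centered (A m)) k m)) +
        t m * (1 / (n : ℝ) * (1 / (n : ℝ) * ∑ k, ∑ l, q k l m)) -
        (√(t m) * (1 / (n : ℝ) *
          ∑ k, lf (fun m => Shrinkage.onesMatrix m (p m)) k m)) ^ 2 := by
      filter_upwards [hnt, hcen, hone] with m h1 h2 h3
      refine (Shrinkage.hatDenominator_add_left hn0 (A m) (W m)).trans ?_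
      simp only [h1, h2, h3, ← Finset.mul_sum]
      simp only [v, a]
      ring
    have hmean : ∀ᶠ m in atTop, Shrinkage.normTrace (Shrinkage.sampleMean
        (fun k => Shrinkage.observation (A m) (S m) (E m k ω)))
          (Shrinkage.onesMatrix m (p m)) = a m + √(t m) * (1 / (n : ℝ) *
          ∑ k, lf (fun m => Shrinkage.onesMatrix m (p m)) k m) := by
      filter_upwards [hone] with m h1
      have h2 : Shrinkage.sampleMean (fun k => Shrinkage.observation (A m) (S m) (E m k ω)) =
          A m + Shrinkage.sampleMean (W m) := Shrinkage.sampleMean_add_left hn0 (A m) (W m)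
      rw [h2, Shrinkage.normTrace_add_left,
        Shrinkage.normTrace_comm (Shrinkage.sampleMean (W m)), Shrinkage.normTrace_sampleMean_right]
      simp only [h1, ← Finset.mul_sum]
      simp only [a]
      ring
    have horacle : ∀ᶠ m in atTop, 1 - Shrinkage.alphaOracle n (A m) (S m) =
        t m / n / (v m + t m / n) := by
      filter_upwards [htpos, hvnn] with m h1 h2
      have h3 : (0 : ℝ) < v m + t m / n := by positivity
      have h4 : Shrinkage.alphaOracle n (A m) (S m) = v m / (v m + t m / n) := by
        rw [Shrinkage.alphaOracle]
        simp only [v, a, t]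
        congr 1
        ring
      rw [h4, one_sub_div h3.ne']
      congr 1
      ring
    obtain ⟨l1, l2, l3, l4⟩ := Shrinkage.plugin_limits (by linarith : (1 : ℝ) ≤ n) htpos hvnn
      (Eventually.of_forall hT) habs hρ hξ hs hη hden
    refine ⟨l1.congr' ?_, l2, l3.congr' ?_, l4.congr' ?_⟩
    · filter_upwards [hpool] with m h1
      rw [h1]
    · filter_upwards [hpool, horacle] with m h1 h2
      rw [h2, Shrinkage.alphaHat_eq, h1, sub_sub_cancel]
    · filter_upwards [hpool, horacle, hmean] with m h1 h2 h3
      rw [Shrinkage.betaHat, Shrinkage.betaOracle, h2, h3, Shrinkage.alphaHat_eq, h1,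
        sub_sub_cancel]
  refine ⟨?_, ?_, ?_, ?_⟩
  · filter_upwards [hmain] with ω h
    simpa [t] using h.1.abs
  · filter_upwards [hmain] with ω h
    exact h.2.1
  · filter_upwards [hmain] with ω h
    have := h.2.2.1.abs
    simp only [sub_sub_sub_cancel_left, abs_zero] at this
    exact this.congr fun m => abs_sub_comm _ _
  · filter_upwards [hmain] with ω h
    simpa using h.2.2.2.abs
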